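/- Identify $\mathbb R^4$ with the quaternions $\mathbb H$ by $(x_1,x_2,x_3,x_4)\leftrightarrow x_1+ix_2+jx_3+kx_4$. For unit quaternions $l,r$ let $[l,r]\in SO(4)$ be the map $x\mapsto \bar l\,x\,r$, and put $e_s=\cos(\pi/s)+i\sin(\pi/s)$. For an integer $m\ge 3$ define the subgroups of $SO(4)$ generated as follows: $$G_1(m)=\langle [e_m,1],[1,i],[1,j],[j,e_4]\rangle,$$ $$G_2(m)=\langle [e_m,1],[1,i],[e_{2m},j],[j,e_4]\rangle,$$ $$G_3(m)=\langle [e_m,1],[1,i],[j,1],[1,j]\rangle.$$ For a subgroup $G\subset SO(4)$ the isotropy subgroup of $x\in\mathbb R^4$ is $G_x=\{g\in G: gx=x\}$; a nontrivial isotropy subgroup is a group $G_x\neq\{1\}$ with $x\ne 0$; an isotropy type is the conjugacy class in $G$ of a nontrivial isotropy subgroup. For a subgroup $H\subset G$ put $\mathrm{Fix}(H)=\{x: hx=x \text{ for all } h\in H\}$; the normalizer $N_G(H)$ acts on $\mathrm{Fix}(H)$. A real representation is absolutely irreducible if it is irreducible and the only linear maps commuting with it are the real multiples of the identity. $\mathbb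 Z_n$ is the cyclic group of order $n$, and $D_2\cong\mathbb Z_2\times\mathbb Z_2$. Theorem. Let $m\ge 3$. 1. For $j=1,2,3$ the group $G_j(m)$ is contained in $SO(4)$, and its natural action on $\mathbb R^4$ is absolutely irreducible. Suppose in addition that $m$ is odd. Then: 2. For $j=1,2,3$ the group $G_j(m)$ has at least one nontrivial isotropy subgroup. Every nontrivial isotropy subgroup $H$ of $G_j(m)$ has order $2$, and $\dim\mathrm{Fix}(H)=2$. Consequently no isotropy subgroup of any point of $\mathbb R^4$ has an odd-dimensional fixed point space. 3. $G_j(m)$ has exactly $j$ isotropy types, for $j=1,2,3$. 4. The normalizers $N=N_{G_j(m)}(H)$ of the nontrivial isotropy subgroups $H$ act on the planes $\mathrm{Fix}(H)$ as follows. (a) $j=1$: for every $H$, $N\cong D_2$, and $N$ acts on $\mathrm{Fix}(H)$ as $\mathbb Z_2$, generated by the rotation through $\pi$. (b) $j=2$: for all $H$ in one of the two isotropy types, $N\cong D_2$, and $N$ acts on $\mathrm{Fix}(H)$ as $\mathbb Z_2$, generated by the rotation through $\pi$; for all $H$ in the other isotropy type, $N\cong\mathbb Z_{2m}\times\mathbb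 Z_2$, and $N$ acts on $\mathrm{Fix}(H)$ as $\mathbb Z_{2m}$, generated by a rotation through $\pi/m$. (c) $j=3$: for every $H$, $N\cong\mathbb Z_4\times\mathbb Z_2$, and $N$ acts on $\mathrm{Fix}(H)$ as $\mathbb Z_4$, generated by a rotation through $\pi/2$. -/

import Mathlib

open scoped Quaternion

noncomputable section

namespace QuatSeries

/-! ### Rotations of four-space in quaternion notation

Euclidean four-space is the space `ℍ[ℝ]` of quaternions with its Euclidean norm; the vector
`(x₁, x₂, x₃, x₄)` is the quaternion `x₁ + i x₂ + j x₃ + k x₄`. -/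

/-- The orthogonal group of Euclidean four-space. -/
abbrev O4 : Type := ℍ[ℝ] ≃ₗᵢ[ℝ] ℍ[ℝ]

/-- The special orthogonal group of Euclidean four-space. -/
def SO4 : Subgroup O4 where
  carrier := {g | LinearMap.det (g.toLinearEquiv : ℍ[ℝ] →ₗ[ℝ] ℍ[ℝ]) = 1}
  one_mem' := by
    change LinearMap.det (LinearMap.id : ℍ[ℝ] →ₗ[ℝ] ℍ[ℝ]) = 1
    simp
  mul_mem' := by
    intro a b ha hb
    change LinearMap.det ((a.toLinearEquiv : ℍ[ℝ] →ₗ[ℝ] ℍ[ℝ]) *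
      (b.toLinearEquiv : ℍ[ℝ] →ₗ[ℝ] ℍ[ℝ])) = 1
    rw [map_mul, ha, hb, one_mul]
  inv_mem' := by
    intro a ha
    have h : ((a⁻¹ : O4).toLinearEquiv : ℍ[ℝ] →ₗ[ℝ] ℍ[ℝ]) *
        (a.toLinearEquiv : ℍ[ℝ] →ₗ[ℝ] ℍ[ℝ]) = 1 := by
      ext1 x
      exact a.symm_apply_apply x
    have h' := congrArg LinearMap.det h
    rw [map_mul, map_one] at h'
    change LinearMap.det (a.toLinearEquiv : ℍ[ℝ] →ₗ[ℝ] ℍ[ℝ]) = 1 at ha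
    rw [ha, mul_one] at h'
    exact h'

/-- The group of unit quaternions. -/
abbrev UnitQuat : Type := unitary ℍ[ℝ]

theorem norm_unitQuat (q : UnitQuat) : ‖(q : ℍ[ℝ])‖ = 1 :=
  CStarRing.norm_of_mem_unitary q.2

/-- The map `[l, r] : x ↦ l̄ x r` for unit quaternions `l` and `r`. -/
def bracket (l r : UnitQuat) : O4 where
  toFun x := star (l : ℍ[ℝ]) * x * r
  invFun x := l * x * star (r : ℍ[ℝ])
  map_add' x y := by rw [mul_add, add_mul]
  map_smul' c x := by simp
  left_inv x := by
    have h1 : (l : ℍ[ℝ]) * star (l : ℍ[ℝ]) = 1 := Unitary.mul_star_self_of_mem l.2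
    have h2 : (r : ℍ[ℝ]) * star (r : ℍ[ℝ]) = 1 := Unitary.mul_star_self_of_mem r.2
    calc (l : ℍ[ℝ]) * (star (l : ℍ[ℝ]) * x * r) * star (r : ℍ[ℝ])
        = ((l : ℍ[ℝ]) * star (l : ℍ[ℝ])) * x * (r * star (r : ℍ[ℝ])) := by
          simp only [mul_assoc]
      _ = x := by rw [h1, h2, one_mul, mul_one]
  right_inv x := by
    have h1 : star (l : ℍ[ℝ]) * (l : ℍ[ℝ]) = 1 := Unitary.star_mul_self_of_mem l.2
    have h2 : star (r : ℍ[ℝ]) * (r : ℍ[ℝ]) = 1 := Unitary.star_mul_self_of_mem r.2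
    calc star (l : ℍ[ℝ]) * ((l : ℍ[ℝ]) * x * star (r : ℍ[ℝ])) * r
        = (star (l : ℍ[ℝ]) * (l : ℍ[ℝ])) * x * (star (r : ℍ[ℝ]) * r) := by
          simp only [mul_assoc]
      _ = x := by rw [h1, h2, one_mul, mul_one]
  norm_map' x := by
    change ‖star (l : ℍ[ℝ]) * x * r‖ = ‖x‖
    rw [norm_mul, norm_mul, norm_star, norm_unitQuat, norm_unitQuat, one_mul, mul_one]

/-- The quaternion `a + i b + j c + k d`. -/
def quat (a b c d : ℝ) : ℍ[ℝ] := ⟨a, b, c, d⟩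

@[simp] theorem quat_re (a b c d : ℝ) : (quat a b c d).re = a := rfl
@[simp] theorem quat_imI (a b c d : ℝ) : (quat a b c d).imI = b := rfl
@[simp] theorem quat_imJ (a b c d : ℝ) : (quat a b c d).imJ = c := rfl
@[simp] theorem quat_imK (a b c d : ℝ) : (quat a b c d).imK = d := rfl

theorem quat_mem_unitary {a b c d : ℝ} (h : a ^ 2 + b ^ 2 + c ^ 2 + d ^ 2 = 1) :
    quat a b c d ∈ unitary ℍ[ℝ] := by
  have hn : Quaternion.normSq (quat a b c d) = 1 := by
    rw [Quaternion.normSq_def']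
    simpa using h
  rw [Unitary.mem_iff]
  constructor
  · rw [Quaternion.star_mul_self, hn, Quaternion.coe_one]
  · rw [Quaternion.self_mul_star, hn, Quaternion.coe_one]

/-- The unit quaternion `i`. -/
def qi : UnitQuat := ⟨quat 0 1 0 0, quat_mem_unitary (by norm_num)⟩

/-- The unit quaternion `j`. -/
def qj : UnitQuat := ⟨quat 0 0 1 0, quat_mem_unitary (by norm_num)⟩

/-- The unit quaternion `e_s = exp(π i / s) = cos(π / s) + i sin(π / s)`. -/
def qe (s : ℕ) : UnitQuat :=
  ⟨quat (Real.cos (Real.pi / s)) (Real.sin (Real.pi / s)) 0 0,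
    quat_mem_unitary (by simp)⟩

/-- `G₁(m) = ⟨[e_m, 1], [1, i], [1, j], [j, e₄]⟩`. -/
def G₁ (m : ℕ) : Subgroup O4 :=
  Subgroup.closure {bracket (qe m) 1, bracket 1 qi, bracket 1 qj, bracket qj (qe 4)}

/-- `G₂(m) = ⟨[e_m, 1], [1, i], [e_{2m}, j], [j, e₄]⟩`. -/
def G₂ (m : ℕ) : Subgroup O4 :=
  Subgroup.closure {bracket (qe m) 1, bracket 1 qi, bracket (qe (2 * m)) qj, bracket qj (qe 4)}

/-- `G₃(m) = ⟨[e_m, 1], [1, i], [j, 1], [1, j]⟩`. -/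
def G₃ (m : ℕ) : Subgroup O4 :=
  Subgroup.closure {bracket (qe m) 1, bracket 1 qi, bracket qj 1, bracket 1 qj}

/-! ### Actions, isotropy subgroups and normalizers -/

/-- The natural representation on four-space of a group of orthogonal transformations. -/
def naturalRep (G : Subgroup O4) : Representation ℝ G ℍ[ℝ] where
  toFun g := ((g : O4).toLinearEquiv : ℍ[ℝ] →ₗ[ℝ] ℍ[ℝ])
  map_one' := rfl
  map_mul' _ _ := rfl

/-- A real representation is absolutely irreducible if it is irreducible and every linear map that
commutes with it is a real multiple of the identity. -/
def IsAbsolutelyIrreducible {G V : Type*} [Group G] [AddCommGroup V] [Module ℝ V]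
    (ρ : Representation ℝ G V) : Prop :=
  ρ.IsIrreducible ∧
    ∀ A : V →ₗ[ℝ] V, (∀ g : G, A ∘ₗ ρ g = ρ g ∘ₗ A) → ∃ c : ℝ, A = c • LinearMap.id

/-- The isotropy subgroup (stabilizer) of the point `x`. -/
def isotropy (G : Subgroup O4) (x : ℍ[ℝ]) : Subgroup G where
  carrier := {g | (g : O4) x = x}
  one_mem' := rfl
  mul_mem' := by
    intro a b ha hb
    change (a : O4) ((b : O4) x) = x
    rw [show (b : O4) x = x from hb]
    exact ha
  inv_mem' := by
    intro a ha
    change (a : O4).symm x = x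
    rw [LinearIsometryEquiv.symm_apply_eq]
    exact (show (a : O4) x = x from ha).symm

/-- The fixed point space `Fix(H)` of a subgroup `H` of `G`. -/
def fixSpace (G : Subgroup O4) (H : Subgroup G) : Submodule ℝ ℍ[ℝ] where
  carrier := {x | ∀ h ∈ H, (h : O4) x = x}
  add_mem' := by
    intro x y hx hy h hh
    rw [map_add, hx h hh, hy h hh]
  zero_mem' := fun h _ => map_zero (h : O4)
  smul_mem' := by
    intro c x hx h hh
    rw [LinearIsometryEquiv.map_smul, hx h hh]

/-- The nontrivial isotropy subgroups: the isotropy subgroups of nonzero points, other than the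
trivial group. -/
def nontrivialIsotropy (G : Subgroup O4) : Set (Subgroup G) :=
  {H | H ≠ ⊥ ∧ ∃ x : ℍ[ℝ], x ≠ 0 ∧ isotropy G x = H}

/-- The conjugacy class in `G` of a subgroup of `G`. -/
def conjClass {G : Type*} [Group G] (H : Subgroup G) : Set (Subgroup G) :=
  {K | ∃ g : G, K = H.map (MulAut.conj g).toMonoidHom}

/-- The isotropy types: the conjugacy classes of nontrivial isotropy subgroups. -/
def isotropyTypes (G : Subgroup O4) : Set (Set (Subgroup G)) :=
  conjClass '' nontrivialIsotropy G

/-- The normalizer of `H` in `G`. -/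
abbrev normalizerIn (G : Subgroup O4) (H : Subgroup G) : Subgroup G :=
  Subgroup.normalizer (H : Set G)

theorem apply_mem_fixSpace (G : Subgroup O4) (H : Subgroup G) (n : normalizerIn G H)
    {x : ℍ[ℝ]} (hx : x ∈ fixSpace G H) : ((n : G) : O4) x ∈ fixSpace G H := by
  intro h hh
  have h1 : (n : G)⁻¹ * h * (n : G) ∈ H := by
    have := (Subgroup.mem_normalizer_iff.1 (normalizerIn G H |>.inv_mem n.2) h).1 hh
    simpa using this
  have h2 := hx _ h1
  have h3 : ((n : G) : O4) ((((n : G)⁻¹ * h * (n : G) : G) : O4) x)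
      = (h : O4) (((n : G) : O4) x) := by
    change ((n : G) : O4) (((n : G) : O4).symm ((h : O4) (((n : G) : O4) x))) = _
    rw [LinearIsometryEquiv.apply_symm_apply]
  rw [h2] at h3
  exact h3.symm

/-- The action of the normalizer of `H` on the fixed point space of `H`. -/
def normalizerAction (G : Subgroup O4) (H : Subgroup G) :
    normalizerIn G H →* (fixSpace G H ≃ₗᵢ[ℝ] fixSpace G H) where
  toFun n :=
    { toFun := fun x => ⟨((n : G) : O4) x, apply_mem_fixSpace G H n x.2⟩
      invFun := fun x => ⟨((n⁻¹ : G) : O4) x, apply_mem_fixSpace G H n⁻¹ x.2⟩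
      map_add' := fun x y => Subtype.ext (map_add ((n : G) : O4) (x : ℍ[ℝ]) y)
      map_smul' := fun c x => Subtype.ext (map_smul ((n : G) : O4) c (x : ℍ[ℝ]))
      left_inv := fun x => Subtype.ext (((n : G) : O4).symm_apply_apply x)
      right_inv := fun x => Subtype.ext (((n : G) : O4).apply_symm_apply x)
      norm_map' := fun x => ((n : G) : O4).norm_map x }
  map_one' := rfl
  map_mul' _ _ := rfl

/-- The fixed point space of `H` is a plane, and the transformations of it that are induced by the
normalizer of `H` are exactly the powers of the rotation through the angle `θ` (for either
orientation of the plane). -/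
def ActsByRotation (G : Subgroup O4) (H : Subgroup G) (θ : ℝ) : Prop :=
  ∃ _ : Fact (Module.finrank ℝ (fixSpace G H) = 2),
    ∀ o : Orientation ℝ (fixSpace G H) (Fin 2),
      (normalizerAction G H).range = Subgroup.zpowers (o.rotation (θ : Real.Angle))

/-- The normalizer of `H` is isomorphic to `A`, and it acts on the fixed point space of `H` as the
cyclic group of order `n`, generated by the rotation through the angle `θ`. -/
def NormalizerActsAs (G : Subgroup O4) (H : Subgroup G) (A : Type) [Group A] (n : ℕ) (θ : ℝ) :
    Prop :=
  Nonempty (normalizerIn G H ≃* A) ∧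
    Nonempty ((normalizerAction G H).range ≃* Multiplicative (ZMod n)) ∧ ActsByRotation G H θ

end QuatSeries

end

open scoped Quaternion

noncomputable section

namespace QuatSeries

/-! ### Unit quaternions -/

/-! The maps `twist l r : x ↦ l x r̄` depend multiplicatively on the pair (l, r), with kernel ±(1,
1), and such a map fixes some nonzero vector exactly when l and r are conjugate unit quaternions.
Everything thus reduces to computing with pairs of unit quaternions.

The three groups are `genGroup m p q` with (p, q) = (0,1), (1,1), (0,0). Because j inverts e_{2m}
and e_4, and j² = -1 is a power of each, every element falls into one of four families, according to
whether j occurs in the left and in the right factor, with parity conditions on the exponents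
(`exists_of_mem_genGroup`). A factor containing j squares to -1. If no j occurs, the pair is (e_m^c,
i^d); for odd m, conjugate factors of this kind are both 1 or both -1 (`qe_zpow_eq_one_or_neg_one`).
So a nontrivial element with a fixed vector has l² = r² = -1: it is an involution whose fixed space
is a plane u(ℝ + ℝr). If p = 0 the left factor of such an involution always contains j, and if q = 1
the right one does. The product of two of them fixing a common vector therefore has a factor without
j, which forces the product to be trivial. Hence nontrivial isotropy groups have order two
(`isSimplyReflected_genGroup`).

The normalizer of ⟨h⟩ is the centralizer of h. Up to multiplication by h it is the cyclic group of
some T acting by multiplication on one side: T is -1, left multiplication by e_m, or right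
multiplication by r̄. Such powers act freely unless trivial, so T acts faithfully on the fixed
plane, as a rotation (`normalizerActsAs_of_centralizer`). Isotropy types are conjugacy classes of
the involutions; they are counted by shifting exponents through conjugation and separated by the
factors that conjugation can reach.

Absolute irreducibility follows from the commutant alone: the generators yield left and right
multiplication by i and j, and only scalars commute with all of these. -/

theorem UnitQuat.ext_components {x y : UnitQuat} (h₀ : (x : ℍ[ℝ]).re = (y : ℍ[ℝ]).re)
    (h₁ : (x : ℍ[ℝ]).imI = (y : ℍ[ℝ]).imI) (h₂ : (x : ℍ[ℝ]).imJ = (y : ℍ[ℝ]).imJ)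
    (h₃ : (x : ℍ[ℝ]).imK = (y : ℍ[ℝ]).imK) : x = y :=
  Subtype.ext (QuaternionAlgebra.ext h₀ h₁ h₂ h₃)

theorem UnitQuat.eq_one_or_neg_one {x : UnitQuat} (h : x ^ 2 = 1) : x = 1 ∨ x = -1 := by
  have h' : (x : ℍ[ℝ]) ^ 2 = 1 := by simpa using congrArg Subtype.val h
  rcases sq_eq_one_iff.1 h' with h | h
  · exact Or.inl (Subtype.ext h)
  · exact Or.inr (Subtype.ext (by rw [h, Unitary.coe_neg]; rfl))

theorem UnitQuat.neg_one_ne_one : (-1 : UnitQuat) ≠ 1 := by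
  intro h
  have h' := congrArg (fun x : UnitQuat => (x : ℍ[ℝ]).re) h
  simp only [Unitary.coe_neg, OneMemClass.coe_one, Quaternion.re_neg, Quaternion.re_one] at h'
  norm_num at h'

theorem UnitQuat.sum_sq (q : UnitQuat) : (q : ℍ[ℝ]).re ^ 2 + (q : ℍ[ℝ]).imI ^ 2 +
    (q : ℍ[ℝ]).imJ ^ 2 + (q : ℍ[ℝ]).imK ^ 2 = 1 := by
  rw [← Quaternion.normSq_def', Quaternion.normSq_eq_norm_mul_self, norm_unitQuat, one_mul]

theorem UnitQuat.coe_inv (q : UnitQuat) : ((q⁻¹ : UnitQuat) : ℍ[ℝ]) = star (q : ℍ[ℝ]) := rfl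

theorem UnitQuat.coe_ne_zero (q : UnitQuat) : (q : ℍ[ℝ]) ≠ 0 := by
  intro h
  have := norm_unitQuat q
  rw [h, norm_zero] at this
  exact zero_ne_one this

theorem UnitQuat.mul_star_self (q : UnitQuat) : (q : ℍ[ℝ]) * star (q : ℍ[ℝ]) = 1 :=
  Unitary.mul_star_self_of_mem q.2

theorem UnitQuat.star_mul_self (q : UnitQuat) : star (q : ℍ[ℝ]) * (q : ℍ[ℝ]) = 1 :=
  Unitary.star_mul_self_of_mem q.2

theorem UnitQuat.coe_mul_self {q : UnitQuat} (h : q ^ 2 = -1) :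
    (q : ℍ[ℝ]) * (q : ℍ[ℝ]) = -1 := by
  simpa [sq, Unitary.coe_neg] using congrArg Subtype.val h

theorem UnitQuat.re_eq_zero {q : UnitQuat} (h : q ^ 2 = -1) : (q : ℍ[ℝ]).re = 0 := by
  have h' := UnitQuat.coe_mul_self h
  have h₀ := congrArg QuaternionAlgebra.re h'
  simp only [Quaternion.re_mul, Quaternion.re_neg, Quaternion.re_one] at h₀
  have h₁ := q.sum_sq
  nlinarith

/-- For l ≠ -1 the root is (1 + l)/|1 + l|, where |1 + l|² = 2 + 2 Re l; for l = -1 it is i. The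
lemma makes each `twist` a square, which settles the sign of its determinant. -/
theorem UnitQuat.exists_sq_eq (l : UnitQuat) : ∃ k : UnitQuat, k ^ 2 = l := by
  have hs := l.sum_sq
  by_cases h : (l : ℍ[ℝ]).re = -1
  · have hI := sq_nonneg (l : ℍ[ℝ]).imI
    have hJ := sq_nonneg (l : ℍ[ℝ]).imJ
    have hK := sq_nonneg (l : ℍ[ℝ]).imK
    rw [h] at hs
    have h₁ : (l : ℍ[ℝ]).imI = 0 := pow_eq_zero_iff two_ne_zero |>.1 (by linarith)
    have h₂ : (l : ℍ[ℝ]).imJ = 0 := pow_eq_zero_iff two_ne_zero |>.1 (by linarith)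
    have h₃ : (l : ℍ[ℝ]).imK = 0 := pow_eq_zero_iff two_ne_zero |>.1 (by linarith)
    refine ⟨qi, UnitQuat.ext_components ?_ ?_ ?_ ?_⟩ <;> simp [sq, qi, h, h₁, h₂, h₃]
  · have hpos : 0 < 2 + 2 * (l : ℍ[ℝ]).re := by
      have : -1 ≤ (l : ℍ[ℝ]).re := by
        nlinarith [sq_nonneg (l : ℍ[ℝ]).imI, sq_nonneg (l : ℍ[ℝ]).imJ,
          sq_nonneg (l : ℍ[ℝ]).imK]
      rcases this.lt_or_eq with h' | h'
      · linarith
      · exact absurd h'.symm h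
    set t := Real.sqrt (2 + 2 * (l : ℍ[ℝ]).re) with ht
    have ht2 : t ^ 2 = 2 + 2 * (l : ℍ[ℝ]).re := Real.sq_sqrt hpos.le
    have ht0 : t ≠ 0 := (Real.sqrt_pos.2 hpos).ne'
    refine ⟨⟨quat ((1 + (l : ℍ[ℝ]).re) / t) ((l : ℍ[ℝ]).imI / t) ((l : ℍ[ℝ]).imJ / t)
      ((l : ℍ[ℝ]).imK / t), quat_mem_unitary ?_⟩, UnitQuat.ext_components ?_ ?_ ?_ ?_⟩
    · field_simp
      linear_combination hs - ht2
    all_goals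
      simp only [sq, Submonoid.coe_mul, Quaternion.re_mul, Quaternion.imI_mul,
        Quaternion.imJ_mul, Quaternion.imK_mul, quat_re, quat_imI, quat_imJ, quat_imK]
      field_simp
    · linear_combination -hs - (l : ℍ[ℝ]).re * ht2
    · linear_combination - (l : ℍ[ℝ]).imI * ht2
    · linear_combination - (l : ℍ[ℝ]).imJ * ht2
    · linear_combination - (l : ℍ[ℝ]).imK * ht2

/-! ### The maps `x ↦ l x r̄` -/

/-- The map `x ↦ l x r̄`; in contrast to `bracket`, it is multiplicative in the pair `(l, r)`. -/
def twist (l r : UnitQuat) : O4 := bracket l⁻¹ r⁻¹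

theorem twist_apply (l r : UnitQuat) (x : ℍ[ℝ]) : twist l r x = l * x * star (r : ℍ[ℝ]) := by
  change star (star (l : ℍ[ℝ])) * x * star (r : ℍ[ℝ]) = _
  rw [star_star]

theorem bracket_eq_twist (l r : UnitQuat) : bracket l r = twist l⁻¹ r⁻¹ := by
  simp [twist]

theorem twist_one : twist 1 1 = 1 := by
  ext1 x
  rw [twist_apply]
  simp

theorem twist_mul (l r l' r' : UnitQuat) :
    twist l r * twist l' r' = twist (l * l') (r * r') := by
  ext1 x
  change twist l r (twist l' r' x) = _
  simp only [twist_apply, Submonoid.coe_mul, star_mul, mul_assoc]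

/-- The homomorphism `(l, r) ↦ (x ↦ l x r̄)`. -/
def twistHom : UnitQuat × UnitQuat →* O4 where
  toFun p := twist p.1 p.2
  map_one' := twist_one
  map_mul' p q := (twist_mul p.1 p.2 q.1 q.2).symm

theorem twist_inv (l r : UnitQuat) : (twist l r)⁻¹ = twist l⁻¹ r⁻¹ :=
  (map_inv twistHom (l, r)).symm

theorem twist_zpow (l r : UnitQuat) (k : ℤ) : twist l r ^ k = twist (l ^ k) (r ^ k) :=
  (map_zpow twistHom (l, r) k).symm

theorem twist_pow (l r : UnitQuat) (k : ℕ) : twist l r ^ k = twist (l ^ k) (r ^ k) :=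
  (map_pow twistHom (l, r) k).symm

theorem twist_neg_neg (l r : UnitQuat) : twist (-l) (-r) = twist l r := by
  ext1 x
  simp [twist_apply, Unitary.coe_neg]

theorem twist_neg_left (l r : UnitQuat) : twist (-l) r = twist l (-r) := by
  rw [← twist_neg_neg, neg_neg]

theorem twist_conj (l r l' r' : UnitQuat) :
    twist l' r' * twist l r * (twist l' r')⁻¹ = twist (l' * l * l'⁻¹) (r' * r * r'⁻¹) := by
  rw [twist_inv, twist_mul, twist_mul]

theorem twist_apply_eq_iff {l r : UnitQuat} {x : ℍ[ℝ]} :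
    twist l r x = x ↔ (l : ℍ[ℝ]) * x = x * r := by
  rw [twist_apply]
  constructor
  · intro h
    calc (l : ℍ[ℝ]) * x = l * x * (star (r : ℍ[ℝ]) * r) := by rw [r.star_mul_self, mul_one]
      _ = (l * x * star (r : ℍ[ℝ])) * r := by simp only [mul_assoc]
      _ = x * r := by rw [h]
  · intro h
    rw [h, mul_assoc, r.mul_star_self, mul_one]

/-- A unit quaternion commuting with `i` and `j` is `1` or `-1`. -/
theorem UnitQuat.eq_one_or_neg_one_of_commute {q : UnitQuat}
    (hi : (q : ℍ[ℝ]) * qi = qi * q) (hj : (q : ℍ[ℝ]) * qj = qj * q) : q = 1 ∨ q = -1 := by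
  apply UnitQuat.eq_one_or_neg_one
  have h₁ := congrArg QuaternionAlgebra.imK hi
  have h₂ := congrArg QuaternionAlgebra.imJ hi
  have h₃ := congrArg QuaternionAlgebra.imK hj
  simp [qi, qj] at h₁ h₂ h₃
  have e₁ : (q : ℍ[ℝ]).imI = 0 := by linarith
  have e₂ : (q : ℍ[ℝ]).imJ = 0 := by linarith
  have e₃ : (q : ℍ[ℝ]).imK = 0 := by linarith
  have hs := q.sum_sq
  rw [e₁, e₂, e₃] at hs
  apply UnitQuat.ext_components <;> simp [sq, e₁, e₂, e₃]
  linarith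

/-- Evaluating at 1 gives l = r; evaluating at i and j then makes l central. -/
theorem twist_eq_one_iff {l r : UnitQuat} :
    twist l r = 1 ↔ (l = 1 ∧ r = 1) ∨ (l = -1 ∧ r = -1) := by
  constructor
  · intro h
    have h' : ∀ x : ℍ[ℝ], (l : ℍ[ℝ]) * x = x * r := fun x =>
      twist_apply_eq_iff.1 (by rw [h]; rfl)
    have hlr : l = r := Subtype.ext (by simpa using h' 1)
    subst hlr
    rcases UnitQuat.eq_one_or_neg_one_of_commute (h' qi) (h' qj) with h | h
    · exact Or.inl ⟨h, h⟩
    · exact Or.inr ⟨h, h⟩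
  · rintro (⟨rfl, rfl⟩ | ⟨rfl, rfl⟩)
    · exact twist_one
    · rw [twist_neg_neg, twist_one]

theorem twist_eq_twist_iff {l r l' r' : UnitQuat} :
    twist l r = twist l' r' ↔ (l = l' ∧ r = r') ∨ (l = -l' ∧ r = -r') := by
  rw [← mul_inv_eq_one, twist_inv, twist_mul, twist_eq_one_iff, mul_inv_eq_one, mul_inv_eq_one,
    mul_inv_eq_iff_eq_mul, mul_inv_eq_iff_eq_mul, neg_one_mul, neg_one_mul]

/-- The fixed vector, scaled to norm one, is itself the conjugating quaternion, since lx = xr. -/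
theorem exists_conj_of_twist_apply_eq {l r : UnitQuat} {x : ℍ[ℝ]} (hx : x ≠ 0)
    (h : twist l r x = x) : ∃ u : UnitQuat, l = u * r * u⁻¹ := by
  have hn : ‖x‖ ≠ 0 := norm_ne_zero_iff.2 hx
  have hu : (‖x‖⁻¹ • x) ∈ unitary ℍ[ℝ] := by
    have hn' : Quaternion.normSq (‖x‖⁻¹ • x) = 1 := by
      rw [Quaternion.normSq_eq_norm_mul_self, norm_smul, norm_inv, norm_norm,
        inv_mul_cancel₀ hn, one_mul]
    rw [Unitary.mem_iff]
    constructor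
    · rw [Quaternion.star_mul_self, hn', Quaternion.coe_one]
    · rw [Quaternion.self_mul_star, hn', Quaternion.coe_one]
  refine ⟨⟨_, hu⟩, eq_mul_inv_of_mul_eq (Subtype.ext ?_)⟩
  change (l : ℍ[ℝ]) * (‖x‖⁻¹ • x) = (‖x‖⁻¹ • x) * r
  rw [mul_smul_comm, smul_mul_assoc, twist_apply_eq_iff.1 h]

theorem det_sq_eq_one (g : O4) :
    LinearMap.det (g.toLinearEquiv : ℍ[ℝ] →ₗ[ℝ] ℍ[ℝ]) ^ 2 = 1 := by
  have h := g.toLinearIsometry.normDet_eq_one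
  rw [LinearMap.normDet_eq_abs_det] at h
  rw [← sq_abs]
  change |LinearMap.det (g.toLinearIsometry.toLinearMap)| ^ 2 = 1
  rw [h, one_pow]

theorem twist_mem_SO4 (l r : UnitQuat) : twist l r ∈ SO4 := by
  obtain ⟨l, rfl⟩ := l.exists_sq_eq
  obtain ⟨r, rfl⟩ := r.exists_sq_eq
  rw [sq, sq, ← twist_mul]
  change LinearMap.det (((twist l r).toLinearEquiv : ℍ[ℝ] →ₗ[ℝ] ℍ[ℝ]) *
    ((twist l r).toLinearEquiv : ℍ[ℝ] →ₗ[ℝ] ℍ[ℝ])) = 1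
  rw [map_mul, ← sq, det_sq_eq_one]

/-! ### Absolute irreducibility -/

/-- For groups of isometries, an irreducible representation is recognized by its commutant. -/
theorem isAbsolutelyIrreducible_of_commutant (G : Subgroup O4)
    (h : ∀ A : ℍ[ℝ] →ₗ[ℝ] ℍ[ℝ], (∀ g ∈ G, ∀ x, A (g x) = g (A x)) →
      ∃ c : ℝ, A = c • LinearMap.id) : IsAbsolutelyIrreducible (naturalRep G) := by
  refine ⟨?_, fun A hA => h A fun g hg x => LinearMap.congr_fun (hA ⟨g, hg⟩) x⟩
  have : Nontrivial (Subrepresentation (naturalRep G)) := by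
    refine ⟨⊥, ⊤, fun hbt => ?_⟩
    have h1 : (1 : ℍ[ℝ]) ∈ (⊤ : Subrepresentation (naturalRep G)).toSubmodule :=
      Submodule.mem_top
    rw [← hbt] at h1
    exact one_ne_zero ((Submodule.mem_bot ℝ).1 h1)
  refine { eq_bot_or_eq_top := fun W => ?_ }
  have hW : ∀ g ∈ G, ∀ x ∈ W.toSubmodule, (g : O4) x ∈ W.toSubmodule := fun g hg x hx =>
    W.apply_mem_toSubmodule ⟨g, hg⟩ hx
  -- The orthogonal projection onto an invariant subspace commutes with the isometries in G, so it
  -- is a scalar c; c = 0 gives the zero subspace and c ≠ 0 the whole space.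
  obtain ⟨c, hc⟩ := h (W.toSubmodule.starProjection : ℍ[ℝ] →L[ℝ] ℍ[ℝ]).toLinearMap (by
    intro g hg x
    change W.toSubmodule.starProjection (g x) = g (W.toSubmodule.starProjection x)
    refine Submodule.eq_starProjection_of_mem_of_inner_eq_zero
      (hW g hg _ (Submodule.starProjection_apply_mem _ _)) fun y hy => ?_
    have h1 := Submodule.starProjection_inner_eq_zero x _ (hW g⁻¹ (G.inv_mem hg) y hy)
    rw [← g.inner_map_map, map_sub] at h1
    rwa [show g (g⁻¹ y) = y from g.apply_symm_apply y] at h1)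
  have hc' : ∀ x, W.toSubmodule.starProjection x = c • x := fun x => LinearMap.congr_fun hc x
  by_cases h0 : c = 0
  · left
    apply Subrepresentation.toSubmodule_injective
    refine (Submodule.eq_bot_iff _).2 fun x hx => ?_
    rw [← Submodule.starProjection_eq_self_iff.2 hx, hc', h0, zero_smul]
  · right
    apply Subrepresentation.toSubmodule_injective
    refine Submodule.eq_top_iff'.2 fun x => ?_
    have h1 : c • x ∈ W.toSubmodule := by
      rw [← hc']
      exact Submodule.starProjection_apply_mem _ _
    simpa [smul_smul, h0] using W.toSubmodule.smul_mem c⁻¹ h1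

/-- A linear map that commutes with the left and right multiplications by `i` and `j` is scalar. -/
theorem eq_smul_id_of_commute (A : ℍ[ℝ] →ₗ[ℝ] ℍ[ℝ])
    (li : ∀ x, A (qi * x) = qi * A x) (lj : ∀ x, A (qj * x) = qj * A x)
    (ri : ∀ x, A (x * qi) = A x * qi) (rj : ∀ x, A (x * qj) = A x * qj) :
    ∃ c : ℝ, A = c • LinearMap.id := by
  -- Since i·1 = 1·i, the value A(1) commutes with i, and likewise with j; hence it is real.
  have hi := (li 1).symm.trans ((congrArg A (by simp)).trans (ri 1))
  have hj := (lj 1).symm.trans ((congrArg A (by simp)).trans (rj 1))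
  have h₁ := congrArg QuaternionAlgebra.imK hi
  have h₂ := congrArg QuaternionAlgebra.imJ hi
  have h₃ := congrArg QuaternionAlgebra.imK hj
  simp [qi, qj] at h₁ h₂ h₃
  obtain ⟨c, hA⟩ : ∃ c : ℝ, A 1 = c • 1 := ⟨(A 1).re, by ext <;> simp <;> linarith⟩
  refine ⟨c, LinearMap.ext fun x => ?_⟩
  have hx : x = x.re • 1 + x.imI • (qi * 1 : ℍ[ℝ]) + x.imJ • (qj * 1 : ℍ[ℝ]) +
      x.imK • (qi * (qj * 1) : ℍ[ℝ]) := by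
    ext <;> simp [qi, qj]
  have hAx := congrArg A hx
  simp only [map_add, map_smul, li, lj] at hAx
  rw [hAx, hA]
  conv_rhs => rw [hx]
  simp only [LinearMap.smul_apply, LinearMap.id_apply, smul_add, mul_smul_comm, mul_one, smul_smul,
    mul_comm]

/-! ### Relations between the generators -/

theorem qe_pow_coe (s k : ℕ) : ((qe s ^ k : UnitQuat) : ℍ[ℝ]) =
    quat (Real.cos (k * (Real.pi / s))) (Real.sin (k * (Real.pi / s))) 0 0 := by
  induction k with
  | zero => rw [pow_zero]; ext <;> simp
  | succ k ih =>
    rw [pow_succ, Submonoid.coe_mul, ih]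
    ext <;> simp [qe, add_mul, Real.cos_add, Real.sin_add]
    ring

theorem qe_two_mul_sq {m : ℕ} (hm : m ≠ 0) : qe (2 * m) ^ 2 = qe m := by
  apply Subtype.ext
  have hm' : (m : ℝ) ≠ 0 := Nat.cast_ne_zero.2 hm
  have h : ((2 : ℕ) : ℝ) * (Real.pi / ((2 * m : ℕ) : ℝ)) = Real.pi / m := by
    push_cast
    field_simp
  rw [qe_pow_coe, h]
  rfl

theorem qe_pow_self {s : ℕ} (hs : s ≠ 0) : qe s ^ s = -1 := by
  apply Subtype.ext
  have hs' : (s : ℝ) ≠ 0 := Nat.cast_ne_zero.2 hs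
  rw [qe_pow_coe, mul_div_cancel₀ _ hs', Unitary.coe_neg]
  ext <;> simp

theorem qe_two : qe 2 = qi := by
  apply Subtype.ext
  ext <;> simp [qe, qi]

theorem qe_four_sq : qe 4 ^ 2 = qi := by
  rw [show 4 = 2 * 2 from rfl, qe_two_mul_sq two_ne_zero, qe_two]

theorem qe_two_mul_pow {m : ℕ} (hm : m ≠ 0) : qe (2 * m) ^ m = qi := by
  apply Subtype.ext
  have hm' : (m : ℝ) ≠ 0 := Nat.cast_ne_zero.2 hm
  have h : (m : ℝ) * (Real.pi / ((2 * m : ℕ) : ℝ)) = Real.pi / 2 := by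
    push_cast
    field_simp
  rw [qe_pow_coe, h]
  ext <;> simp [qi]

theorem qi_sq : qi ^ 2 = -1 := by
  rw [← qe_two, qe_pow_self two_ne_zero]

theorem qj_sq : qj ^ 2 = -1 := by
  apply UnitQuat.ext_components <;> simp [sq, qj, Unitary.coe_neg]

theorem qj_mul_qe (s : ℕ) : qj * qe s * qj⁻¹ = (qe s)⁻¹ := by
  rw [mul_inv_eq_iff_eq_mul]
  apply UnitQuat.ext_components <;> simp [qj, qe, UnitQuat.coe_inv]

theorem orderOf_qe {s : ℕ} (hs : s ≠ 0) : orderOf (qe s) = 2 * s := by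
  have hs' : (s : ℝ) ≠ 0 := Nat.cast_ne_zero.2 hs
  apply Nat.dvd_antisymm
  · apply orderOf_dvd_of_pow_eq_one
    rw [mul_comm, pow_mul, qe_pow_self hs, neg_one_sq]
  · have h := congrArg (fun x : UnitQuat => (x : ℍ[ℝ]).re) (pow_orderOf_eq_one (qe s))
    simp only [qe_pow_coe, quat_re, OneMemClass.coe_one, Quaternion.re_one] at h
    obtain ⟨n, hn⟩ := (Real.cos_eq_one_iff _).1 h
    have h' : (orderOf (qe s) : ℝ) = 2 * s * n := by
      field_simp at hn
      linarith
    have h'' : (orderOf (qe s) : ℤ) = 2 * s * n := by exact_mod_cast h'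
    exact Int.natCast_dvd_natCast.1 ⟨n, by push_cast; exact h''⟩

/-! ### Powers of an element that inverts another. -/

section Inverting

variable {Γ : Type*} [Group Γ] {x y : Γ}

theorem conj_zpow_eq_zpow_neg (h : y * x * y⁻¹ = x⁻¹) (a : ℤ) : y * x ^ a * y⁻¹ = x ^ (-a) := by
  rw [← conj_zpow, h, inv_zpow']

theorem mul_zpow_eq_zpow_neg_mul (h : y * x * y⁻¹ = x⁻¹) (a : ℤ) : y * x ^ a = x ^ (-a) * y := by
  rw [← conj_zpow_eq_zpow_neg h, inv_mul_cancel_right]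

/-- As y² commutes with x, only the parity of s matters. The sign is independent of a, so that one
sign serves all products with the same s. -/
theorem exists_sign_zpow_mul_zpow (h : y * x * y⁻¹ = x⁻¹) (s : ℤ) :
    ∃ ε : ℤ, (ε = 1 ∨ ε = -1) ∧ ∀ a : ℤ, y ^ s * x ^ a = x ^ (ε * a) * y ^ s := by
  have h2 : y ^ 2 * x = x * y ^ 2 := by
    have h1 := mul_zpow_eq_zpow_neg_mul h (-1)
    have h0 := mul_zpow_eq_zpow_neg_mul h 1
    simp only [zpow_one, neg_neg] at h0 h1
    rw [sq, mul_assoc, h0, ← mul_assoc, h1, mul_assoc]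
  have h2' : ∀ k a : ℤ, y ^ (2 * k) * x ^ a = x ^ a * y ^ (2 * k) := fun k a => by
    rw [zpow_mul]
    exact (show Commute (y ^ (2 : ℤ)) x by rw [zpow_ofNat]; exact h2).zpow_zpow k a
  obtain ⟨k, rfl | rfl⟩ := Int.even_or_odd' s
  · exact ⟨1, Or.inl rfl, fun a => by rw [one_mul, h2']⟩
  · refine ⟨-1, Or.inr rfl, fun a => ?_⟩
    rw [zpow_add, zpow_one, mul_assoc, mul_zpow_eq_zpow_neg_mul h, ← mul_assoc, h2', mul_assoc,
      neg_one_mul]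

end Inverting

/-! ### The three series in uniform notation -/

/-- The group generated by `[e_m, 1]`, `[1, i]`, `[e_{2m}^p, j]` and `[j, e₄^q]`. -/
def genGroup (m p q : ℕ) : Subgroup O4 :=
  Subgroup.closure {bracket (qe m) 1, bracket 1 qi, bracket (qe (2 * m) ^ p) qj,
    bracket qj (qe 4 ^ q)}

theorem G₁_eq (m : ℕ) : G₁ m = genGroup m 0 1 := by
  rw [G₁, genGroup, pow_zero, pow_one]

theorem G₂_eq (m : ℕ) : G₂ m = genGroup m 1 1 := by
  rw [G₂, genGroup, pow_one, pow_one]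

theorem G₃_eq (m : ℕ) : G₃ m = genGroup m 0 0 := by
  rw [G₃, genGroup, pow_zero, pow_zero, Set.pair_comm]

/-- The normal form of the elements of `genGroup`. -/
def word (m : ℕ) (a s b t : ℤ) : O4 := twist (qe (2 * m) ^ a * qj ^ s) (qe 4 ^ b * qj ^ t)

theorem exists_word_mul (m : ℕ) (s t : ℤ) : ∃ ε δ : ℤ, (ε = 1 ∨ ε = -1) ∧ (δ = 1 ∨ δ = -1) ∧
    ∀ a b a' s' b' t' : ℤ, word m a s b t * word m a' s' b' t' =
      word m (a + ε * a') (s + s') (b + δ * b') (t + t') := by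
  obtain ⟨ε, hε, h⟩ := exists_sign_zpow_mul_zpow (qj_mul_qe (2 * m)) s
  obtain ⟨δ, hδ, h'⟩ := exists_sign_zpow_mul_zpow (qj_mul_qe 4) t
  refine ⟨ε, δ, hε, hδ, fun a b a' s' b' t' => ?_⟩
  have key : ∀ {Γ : Type} [Group Γ] (x y : Γ) (ε s a a' s' : ℤ),
      y ^ s * x ^ a' = x ^ (ε * a') * y ^ s →
      x ^ a * y ^ s * (x ^ a' * y ^ s') = x ^ (a + ε * a') * y ^ (s + s') := by
    intro Γ _ x y ε s a a' s' h
    rw [zpow_add, zpow_add, mul_assoc, ← mul_assoc (y ^ s), h]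
    simp only [mul_assoc]
  rw [word, word, twist_mul, word, key _ _ _ _ _ _ _ (h a'), key _ _ _ _ _ _ _ (h' b')]

theorem word_zero (m : ℕ) : word m 0 0 0 0 = 1 := by
  simp [word, twist_one]

/-- Signs are invisible modulo 2, so the parity conditions on words survive the twisted addition of
exponents. -/
theorem even_add_sign_mul {ε a a' x x' p : ℤ} (hε : ε = 1 ∨ ε = -1) (h : Even (a - p * x))
    (h' : Even (a' - p * x')) : Even (a + ε * a' - p * (x + x')) := by
  obtain ⟨y, hy⟩ := h
  obtain ⟨y', hy'⟩ := h'
  rcases hε with rfl | rfl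
  · exact ⟨y + y', by linear_combination hy + hy'⟩
  · exact ⟨y + y' - a', by linear_combination hy + hy'⟩

/-- The words satisfying the parity conditions of `genGroup`. -/
def wordGroup (m p q : ℕ) : Subgroup O4 where
  carrier := {g | ∃ a s b t : ℤ, Even (a - p * t) ∧ Even (b - q * s) ∧ g = word m a s b t}
  one_mem' := ⟨0, 0, 0, 0, by simp, by simp, (word_zero m).symm⟩
  mul_mem' := by
    rintro _ _ ⟨a, s, b, t, ha, hb, rfl⟩ ⟨a', s', b', t', ha', hb', rfl⟩
    obtain ⟨ε, δ, hε, hδ, h⟩ := exists_word_mul m s t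
    exact ⟨_, _, _, _, even_add_sign_mul hε ha ha', even_add_sign_mul hδ hb hb', h ..⟩
  inv_mem' := by
    rintro _ ⟨a, s, b, t, ha, hb, rfl⟩
    obtain ⟨ε, δ, hε, hδ, h⟩ := exists_word_mul m s t
    refine ⟨-(ε * a), -s, -(δ * b), -t, ?_, ?_, ?_⟩
    · have := even_add_sign_mul (x := 0) (a := 0) (x' := -t) (a' := -a) hε
        (by simp) (by simpa [neg_add_eq_sub] using ha.neg)
      simpa using this
    · have := even_add_sign_mul (x := 0) (a := 0) (x' := -s) (a' := -b) hδ
        (by simp) (by simpa [neg_add_eq_sub] using hb.neg)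
      simpa using this
    · rw [inv_eq_iff_mul_eq_one, h, ← word_zero m]
      rcases hε with rfl | rfl <;> rcases hδ with rfl | rfl <;> congr 1 <;> ring

/-- Only this inclusion is needed: the particular elements used later are written as products of
generators. -/
theorem genGroup_le_wordGroup {m : ℕ} (hm : m ≠ 0) (p q : ℕ) : genGroup m p q ≤ wordGroup m p q := by
  rw [genGroup, Subgroup.closure_le]
  rintro _ (rfl | rfl | rfl | rfl)
  all_goals rw [bracket_eq_twist, ← twist_inv]; apply Subgroup.inv_mem
  · exact ⟨2, 0, 0, 0, by simp, by simp, by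
      simp only [word, zpow_zero, mul_one]
      rw [← qe_two_mul_sq hm]
      rfl⟩
  · exact ⟨0, 0, 2, 0, by simp, by simp, by
      simp only [word, zpow_zero, mul_one]
      rw [← qe_four_sq]
      rfl⟩
  · exact ⟨p, 0, 0, 1, by simp, by simp, by simp [word]⟩
  · exact ⟨0, 1, q, 0, by simp, by simp, by simp [word]⟩

theorem twist_qe_mem (m p q : ℕ) (c : ℤ) : twist (qe m ^ c) 1 ∈ genGroup m p q := by
  have h : bracket (qe m) 1 ∈ genGroup m p q := Subgroup.subset_closure (by simp)
  have h' := (genGroup m p q).zpow_mem h (-c)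
  rwa [bracket_eq_twist, twist_zpow, inv_zpow', inv_zpow', neg_neg, one_zpow] at h'

theorem twist_qi_mem (m p q : ℕ) (d : ℤ) : twist 1 (qi ^ d) ∈ genGroup m p q := by
  have h : bracket 1 qi ∈ genGroup m p q := Subgroup.subset_closure (by simp)
  have h' := (genGroup m p q).zpow_mem h (-d)
  rwa [bracket_eq_twist, twist_zpow, inv_zpow', inv_zpow', neg_neg, one_zpow] at h'

theorem twist_one_qj_mem (m p q : ℕ) : twist (qe (2 * m) ^ p) qj ∈ genGroup m p q := by
  have h : bracket (qe (2 * m) ^ p) qj ∈ genGroup m p q := Subgroup.subset_closure (by simp)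
  have h' := (genGroup m p q).inv_mem h
  rwa [bracket_eq_twist, twist_inv, inv_inv, inv_inv] at h'

theorem twist_qj_one_mem (m p q : ℕ) : twist qj (qe 4 ^ q) ∈ genGroup m p q := by
  have h : bracket qj (qe 4 ^ q) ∈ genGroup m p q := Subgroup.subset_closure (by simp)
  have h' := (genGroup m p q).inv_mem h
  rwa [bracket_eq_twist, twist_inv, inv_inv, inv_inv] at h'

theorem neg_one_eq_qe_zpow {m : ℕ} (hm : m ≠ 0) (k : ℤ) :
    (-1 : UnitQuat) ^ k = qe m ^ (m * k) := by
  rw [zpow_mul, zpow_natCast, qe_pow_self hm]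

/-- Since j² = -1 = e_n^n, the exponent of j reduces to 0 or 1 at the price of a multiple of n in
the exponent of e_n. This price is even for n = 2m and n = 4. -/
theorem exists_qe_zpow_mul_qj_zpow {n : ℕ} (hn : n ≠ 0) (s : ℤ) :
    ∃ k : ℤ, ∃ s' : ℤ, (s' = 0 ∨ s' = 1) ∧ s = s' + 2 * k ∧
      qj ^ s = qe n ^ (n * k) * qj ^ s' := by
  obtain ⟨k, rfl | rfl⟩ := Int.even_or_odd' s
  · refine ⟨k, 0, Or.inl rfl, by ring, ?_⟩
    rw [← neg_one_eq_qe_zpow hn, zpow_zero, mul_one, ← qj_sq, zpow_mul]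
    rfl
  · refine ⟨k, 1, Or.inr rfl, by ring, ?_⟩
    rw [← neg_one_eq_qe_zpow hn, ← qj_sq, zpow_add, zpow_mul]
    rfl

theorem qe_two_mul_zpow {m : ℕ} (hm : m ≠ 0) (c : ℤ) : qe (2 * m) ^ (2 * c) = qe m ^ c := by
  rw [zpow_mul, ← qe_two_mul_sq hm]
  rfl

theorem qe_four_zpow (c : ℤ) : qe 4 ^ (2 * c) = qi ^ c := by
  rw [zpow_mul, ← qe_four_sq]
  rfl

/-- The elements of `genGroup`. -/
theorem exists_of_mem_genGroup {m p q : ℕ} (hm : m ≠ 0) {g : O4} (hg : g ∈ genGroup m p q) :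
    ∃ c d : ℤ, g = twist (qe (2 * m) ^ (2 * c)) (qe 4 ^ (2 * d)) ∨
      g = twist (qe (2 * m) ^ (2 * c + p)) (qe 4 ^ (2 * d) * qj) ∨
      g = twist (qe (2 * m) ^ (2 * c) * qj) (qe 4 ^ (2 * d + q)) ∨
      g = twist (qe (2 * m) ^ (2 * c + p) * qj) (qe 4 ^ (2 * d + q) * qj) := by
  obtain ⟨a, s, b, t, ⟨x, hx⟩, ⟨y, hy⟩, rfl⟩ := genGroup_le_wordGroup hm p q hg
  obtain ⟨k, s', hs', rfl, hs⟩ := exists_qe_zpow_mul_qj_zpow (n := 2 * m) (by omega) s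
  obtain ⟨l, t', ht', rfl, ht⟩ := exists_qe_zpow_mul_qj_zpow (n := 4) (by omega) t
  have ha : a + (2 * m : ℕ) * k = 2 * (x + p * l + m * k) + p * t' := by
    push_cast
    linear_combination hx
  have hb : b + (4 : ℕ) * l = 2 * (y + q * k + 2 * l) + q * s' := by
    push_cast
    linear_combination hy
  rw [word, hs, ht, ← mul_assoc, ← mul_assoc, ← zpow_add, ← zpow_add, ha, hb]
  refine ⟨x + p * l + m * k, y + q * k + 2 * l, ?_⟩
  rcases hs' with rfl | rfl <;> rcases ht' with rfl | rfl <;> simp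

theorem genGroup_le_SO4 (m p q : ℕ) : genGroup m p q ≤ SO4 := by
  rw [genGroup, Subgroup.closure_le]
  rintro _ (rfl | rfl | rfl | rfl)
  all_goals
    rw [bracket_eq_twist]
    exact twist_mem_SO4 _ _

theorem twist_mem_of_eq_mul {G : Subgroup O4} {l r l₁ r₁ l₂ r₂ : UnitQuat}
    (h₁ : twist l₁ r₁ ∈ G) (h₂ : twist l₂ r₂ ∈ G) (hl : l = l₁ * l₂) (hr : r = r₁ * r₂) :
    twist l r ∈ G := by
  rw [hl, hr, ← twist_mul]
  exact G.mul_mem h₁ h₂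

/-- The natural action of `genGroup` is absolutely irreducible. -/
theorem isAbsolutelyIrreducible_genGroup {m : ℕ} (hm : 3 ≤ m) (p q : ℕ) :
    IsAbsolutelyIrreducible (naturalRep (genGroup m p q)) := by
  refine isAbsolutelyIrreducible_of_commutant _ fun A hA => ?_
  have hp : 0 < Real.pi / m := by positivity
  have hp' : Real.pi / m < Real.pi := by
    apply div_lt_self Real.pi_pos
    exact_mod_cast (by omega : 1 < m)
  have hsin : Real.sin (Real.pi / m) ≠ 0 := (Real.sin_pos_of_pos_of_lt_pi hp hp').ne'
  have hqe : ∀ s : ℕ, ∀ x : ℍ[ℝ], (qe s : ℍ[ℝ]) =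
      Real.cos (Real.pi / s) • (1 : ℍ[ℝ]) + Real.sin (Real.pi / s) • (qi : ℍ[ℝ]) := by
    intro s x
    ext <;> simp [qe, qi]
  have li : ∀ x, A (qi * x) = qi * A x := by
    intro x
    -- Write e_m = cos(π/m) + sin(π/m) i: the cosine terms cancel and the sine is nonzero.
    have h := hA _ (twist_qe_mem m p q 1) x
    simp only [zpow_one, twist_apply, OneMemClass.coe_one, star_one, mul_one, hqe m 1, add_mul,
      smul_mul_assoc, map_add, map_smul, one_mul, add_right_inj] at h
    exact smul_right_injective _ hsin h
  have hci : ∀ c : ℍ[ℝ], c.imJ = 0 → c.imK = 0 → c = c.re • (1 : ℍ[ℝ]) + c.imI • (qi : ℍ[ℝ]) := by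
    intro c h₁ h₂
    ext <;> simp [qi, h₁, h₂]
  have lc : ∀ c : ℍ[ℝ], c.imJ = 0 → c.imK = 0 → ∀ x, A (c * x) = c * A x := by
    intro c h₁ h₂ x
    rw [hci c h₁ h₂]
    simp only [add_mul, smul_mul_assoc, map_add, map_smul, one_mul, li]
  have ri' : ∀ x, A (x * star (qi : ℍ[ℝ])) = A x * star (qi : ℍ[ℝ]) := by
    intro x
    simpa [twist_apply] using hA _ (twist_qi_mem m p q 1) x
  have hstar : star (qi : ℍ[ℝ]) = -(qi : ℍ[ℝ]) := by
    ext <;> simp [qi]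
  have hstarj : star (qj : ℍ[ℝ]) = -(qj : ℍ[ℝ]) := by
    ext <;> simp [qj]
  have ri : ∀ x, A (x * qi) = A x * qi := by
    intro x
    simpa [hstar] using ri' x
  have rc : ∀ c : ℍ[ℝ], c.imJ = 0 → c.imK = 0 → ∀ x, A (x * c) = A x * c := by
    intro c h₁ h₂ x
    rw [hci c h₁ h₂]
    simp only [mul_add, mul_smul_comm, map_add, map_smul, mul_one, ri]
  have rj : ∀ x, A (x * qj) = A x * qj := by
    intro x
    -- The left factor e_{2m}^p lies in ℝ + ℝi, with which A is already known to commute, so it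
    -- cancels.
    have h := hA _ (twist_one_qj_mem m p q) x
    rw [twist_apply, twist_apply, qe_pow_coe, mul_assoc, lc _ rfl rfl, mul_assoc] at h
    have hne : quat (Real.cos (p * (Real.pi / (2 * m : ℕ)))) (Real.sin (p * (Real.pi / (2 * m : ℕ))))
        0 0 ≠ 0 := by
      rw [← qe_pow_coe]
      exact UnitQuat.coe_ne_zero _
    have h' := mul_left_cancel₀ hne h
    simpa [hstarj] using h'
  have lj : ∀ x, A (qj * x) = qj * A x := by
    intro x
    have h := hA _ (twist_qj_one_mem m p q) x
    rw [twist_apply, twist_apply, qe_pow_coe, rc _ (by simp) (by simp)] at h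
    have hne : star (quat (Real.cos (q * (Real.pi / (4 : ℕ)))) (Real.sin (q * (Real.pi / (4 : ℕ))))
        0 0) ≠ 0 := by
      rw [← qe_pow_coe]
      exact star_ne_zero.2 (UnitQuat.coe_ne_zero _)
    exact mul_right_cancel₀ hne h
  exact eq_smul_id_of_commute A li lj ri rj

/-! ### Rotations of a plane -/

section Plane

variable {V : Type*} [NormedAddCommGroup V] [InnerProductSpace ℝ V]
  [Fact (Module.finrank ℝ V = 2)] (o : Orientation ℝ V (Fin 2))

/-- A complex structure on an oriented Euclidean plane that preserves the norm is one of the two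
rotations through a right angle. -/
theorem eq_rightAngleRotation_or_neg (K : V →ₗ[ℝ] V) (hK : ∀ x, K (K x) = -x)
    (hn : ∀ x, ‖K x‖ = ‖x‖) :
    (∀ x, K x = o.rightAngleRotation x) ∨ ∀ x, K x = -o.rightAngleRotation x := by
  have hd : Module.finrank ℝ V = 2 := Fact.out
  have : Nontrivial V := Module.nontrivial_of_finrank_pos (R := ℝ) (by omega)
  obtain ⟨v, hv⟩ := exists_ne (0 : V)
  have hinner : ∀ x y, inner ℝ (K x) (K y) = inner ℝ x y :=
    (LinearMap.norm_map_iff_inner_map_map K).1 hn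
  -- K preserves inner products and K² = -1, so K is skew; in a plane, Kv is then a multiple of the
  -- right-angle rotation of v.
  have h0 : inner ℝ v (K v) = 0 := by
    have h := hinner v (K v)
    rw [hK, inner_neg_right, real_inner_comm] at h
    linarith
  obtain h0 | ⟨c, hc⟩ := o.inner_eq_zero_iff_eq_zero_or_eq_smul_rotation_pi_div_two.1 h0
  · exact absurd h0 hv
  rw [o.rotation_pi_div_two] at hc
  have hc2 : c ^ 2 = 1 := by
    have h := hn v
    rw [← hc, norm_smul, LinearIsometryEquiv.norm_map] at h
    have h' : |c| = 1 := mul_right_cancel₀ (norm_ne_zero_iff.2 hv) (by simpa using h)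
    rw [← sq_abs, h', one_pow]
  have hJ : K (o.rightAngleRotation v) = -(c • v) := by
    have h := congrArg K hc
    rw [map_smul, hK] at h
    have h' := congrArg (c • ·) h
    simpa [smul_smul, ← sq, hc2] using h'
  have key : ∀ x, K x = c • o.rightAngleRotation x := by
    have hlin : K = c • (o.rightAngleRotation.toLinearEquiv : V →ₗ[ℝ] V) := by
      refine (o.basisRightAngleRotation v hv).ext fun i => ?_
      fin_cases i
      · simpa using hc.symm
      · simpa using hJ
    exact fun x => LinearMap.congr_fun hlin x
  rcases sq_eq_one_iff.1 hc2 with rfl | rfl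
  · exact Or.inl fun x => by rw [key, one_smul]
  · exact Or.inr fun x => by rw [key, neg_one_smul]

/-- K is one of the two right-angle rotations, so T is the rotation through θ or -θ; both generate
the same group, whatever the orientation. -/
theorem zpowers_eq_zpowers_rotation (T : V ≃ₗᵢ[ℝ] V) (K : V →ₗ[ℝ] V) (hK : ∀ x, K (K x) = -x)
    (hn : ∀ x, ‖K x‖ = ‖x‖) (θ : ℝ)
    (hT : ∀ x, T x = Real.cos θ • x + Real.sin θ • K x) :
    Subgroup.zpowers T = Subgroup.zpowers (o.rotation (θ : Real.Angle)) := by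
  rcases eq_rightAngleRotation_or_neg o K hK hn with h | h
  · congr 1
    ext1 x
    rw [hT, o.rotation_apply, h, Real.Angle.cos_coe, Real.Angle.sin_coe]
  · rw [← Subgroup.zpowers_inv]
    congr 1
    rw [inv_eq_iff_eq_inv]
    ext1 x
    change _ = (o.rotation (θ : Real.Angle)).symm x
    rw [hT, o.rotation_symm, o.rotation_apply, h, Real.Angle.cos_neg, Real.Angle.sin_neg,
      Real.Angle.cos_coe, Real.Angle.sin_coe, smul_neg, neg_smul]

end Plane

/-! ### Generalities on groups -/

theorem mem_zpowers_of_sq {Γ : Type*} [Group Γ] {h g : Γ} (h2 : h ^ 2 = 1) (hg : g ∈ Subgroup.zpowers h) :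
    g = 1 ∨ g = h := by
  obtain ⟨k, rfl⟩ := hg
  have hsq' : h ^ (2 : ℤ) = 1 := by rw [zpow_ofNat, h2]
  obtain ⟨c, rfl | rfl⟩ := Int.even_or_odd' k
  · exact Or.inl (by simp only [zpow_mul, hsq', one_zpow])
  · exact Or.inr (by simp only [zpow_add, zpow_mul, hsq', one_zpow, one_mul, zpow_one])

theorem nonempty_mulEquiv_zmod_prod {Γ : Type*} [Group Γ] {T h : Γ} (hTh : Commute T h)
    (h2 : orderOf h = 2) (hmem : h ∉ Subgroup.zpowers T)
    (hgen : ∀ g : Γ, ∃ k : ℤ, g = T ^ k ∨ g = T ^ k * h) :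
    Nonempty (Γ ≃* Multiplicative (ZMod (orderOf T) × ZMod 2)) := by
  have hcomm : ∀ (a : Subgroup.zpowers T) (b : Subgroup.zpowers h),
      Commute ((Subgroup.zpowers T).subtype a) ((Subgroup.zpowers h).subtype b) := by
    rintro ⟨_, a, rfl⟩ ⟨_, b, rfl⟩
    exact hTh.zpow_zpow a b
  have hh : ∀ b ∈ Subgroup.zpowers h, b = 1 ∨ b = h := fun b hb =>
    mem_zpowers_of_sq (h2 ▸ pow_orderOf_eq_one h) hb
  let f := MonoidHom.noncommCoprod (Subgroup.zpowers T).subtype (Subgroup.zpowers h).subtype hcomm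
  have hf : Function.Bijective f := by
    constructor
    · rw [injective_iff_map_eq_one]
      rintro ⟨⟨a, ha⟩, b, hb⟩ hab
      have hab' : a * b = 1 := hab
      rcases hh b hb with rfl | rfl
      · simpa using hab'
      · refine absurd ?_ hmem
        rw [mul_eq_one_iff_eq_inv.1 hab'] at ha
        simpa using ha
    · intro g
      obtain ⟨k, rfl | rfl⟩ := hgen g
      · exact ⟨(⟨T ^ k, k, rfl⟩, 1), mul_one (T ^ k)⟩
      · exact ⟨(⟨T ^ k, k, rfl⟩, ⟨h, Subgroup.mem_zpowers h⟩), rfl⟩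
  have e₁ : Subgroup.zpowers T ≃* Multiplicative (ZMod (orderOf T)) :=
    mulEquivOfCyclicCardEq ((Nat.card_zpowers T).trans (Nat.card_zmod _).symm)
  have e₂ : Subgroup.zpowers h ≃* Multiplicative (ZMod 2) :=
    mulEquivOfCyclicCardEq ((Nat.card_zpowers h).trans (h2.trans (Nat.card_zmod 2).symm))
  exact ⟨(MulEquiv.ofBijective f hf).symm.trans
    ((e₁.prodCongr e₂).trans (MulEquiv.prodMultiplicative _ _).symm)⟩

/-! ### Subgroups of order two: normalizers and conjugacy classes. -/

section Conj

variable {Γ : Type*} [Group Γ]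

theorem zpowers_injective_of_sq {h g : Γ} (h2 : h ^ 2 = 1) (hg1 : g ≠ 1)
    (hgh : Subgroup.zpowers g = Subgroup.zpowers h) : g = h :=
  (mem_zpowers_of_sq h2 (hgh ▸ Subgroup.mem_zpowers g)).resolve_left hg1

theorem map_conj_zpowers (g h : Γ) :
    (Subgroup.zpowers h).map (MulAut.conj g).toMonoidHom = Subgroup.zpowers (g * h * g⁻¹) := by
  rw [MonoidHom.map_zpowers]
  rfl

/-- Conjugation preserving {1, h} must fix h. -/
theorem mem_normalizer_zpowers_iff {h n : Γ} (h2 : h ^ 2 = 1) (h1 : h ≠ 1) :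
    n ∈ Subgroup.normalizer (Subgroup.zpowers h : Set Γ) ↔ n * h = h * n := by
  constructor
  · intro hn
    have h' := (Subgroup.mem_normalizer_iff.1 hn h).1 (Subgroup.mem_zpowers h)
    rcases mem_zpowers_of_sq h2 h' with h' | h'
    · exact absurd (conj_eq_one_iff.1 h') h1
    · exact mul_inv_eq_iff_eq_mul.1 h'
  · intro hn
    rw [← Subgroup.coe_toSubmonoid, Subgroup.coe_toSubmonoid, Subgroup.mem_normalizer_iff]
    have hc : Commute n h := hn
    intro g
    constructor
    · rintro ⟨k, rfl⟩
      refine ⟨k, ?_⟩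
      exact (mul_inv_eq_iff_eq_mul.2 (hc.zpow_right k).eq).symm
    · rintro ⟨k, hk⟩
      refine ⟨k, ?_⟩
      have h3 : n * h ^ k * n⁻¹ = n * g * n⁻¹ := by
        rw [← hk]
        exact mul_inv_eq_iff_eq_mul.2 (hc.zpow_right k).eq
      exact mul_left_cancel (mul_right_cancel h3)

theorem conjClass_map (g : Γ) (H : Subgroup Γ) :
    conjClass (H.map (MulAut.conj g).toMonoidHom) = conjClass H := by
  ext K
  constructor
  · rintro ⟨k, rfl⟩
    refine ⟨k * g, ?_⟩
    rw [Subgroup.map_map]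
    congr 1
    ext x
    simp [mul_assoc]
  · rintro ⟨k, rfl⟩
    refine ⟨k * g⁻¹, ?_⟩
    rw [Subgroup.map_map]
    congr 1
    ext x
    simp [mul_assoc]

theorem self_mem_conjClass (H : Subgroup Γ) : H ∈ conjClass H := by
  refine ⟨1, ?_⟩
  rw [map_one]
  exact (Subgroup.map_id H).symm

theorem conjClass_zpowers_eq_iff {h h' : Γ} (h2 : h ^ 2 = 1) (h1' : h' ≠ 1) :
    conjClass (Subgroup.zpowers h) = conjClass (Subgroup.zpowers h') ↔ IsConj h h' := by
  rw [isConj_iff]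
  constructor
  · intro hc
    have h3 := self_mem_conjClass (Subgroup.zpowers h')
    rw [← hc] at h3
    obtain ⟨g, hg⟩ := h3
    rw [map_conj_zpowers] at hg
    refine ⟨g, (zpowers_injective_of_sq ?_ h1' hg).symm⟩
    rw [conj_pow, h2, mul_one, mul_inv_cancel]
  · rintro ⟨g, rfl⟩
    rw [← map_conj_zpowers, conjClass_map]

end Conj

/-! ### Involutions with a fixed plane -/

section Fix

variable {l r : UnitQuat}

theorem twist_pow_two_eq_one (hl : l ^ 2 = -1) (hr : r ^ 2 = -1) : twist l r ^ 2 = 1 := by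
  rw [twist_pow, hl, hr, twist_neg_neg, twist_one]

theorem twist_ne_one (hl : l ^ 2 = -1) : twist l r ≠ 1 := by
  intro h
  have h1 : l ^ 2 = 1 := by
    rcases twist_eq_one_iff.1 h with ⟨rfl, -⟩ | ⟨rfl, -⟩
    · exact one_pow 2
    · exact neg_one_sq
  exact UnitQuat.neg_one_ne_one (hl.symm.trans h1)

/-- Averaging over the involution: since r̄ = -r, the vector y - l y r is y plus its image, hence
fixed. If it vanished for all y, the involution would be -1, contradicting l² = -1. -/
theorem exists_twist_apply_eq (hl : l ^ 2 = -1) (hr : r ^ 2 = -1) :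
    ∃ x : ℍ[ℝ], x ≠ 0 ∧ twist l r x = x := by
  by_contra! hcon
  have hl' := UnitQuat.coe_mul_self hl
  have hr' := UnitQuat.coe_mul_self hr
  have h : ∀ y : ℍ[ℝ], y = l * y * r := by
    intro y
    by_contra hy
    refine hcon (y - l * y * r) (sub_ne_zero.2 hy) (twist_apply_eq_iff.2 ?_)
    rw [mul_sub, sub_mul, mul_assoc (l * y : ℍ[ℝ]), hr', ← mul_assoc, ← mul_assoc, hl']
    simp only [neg_mul, one_mul, mul_neg, mul_one]
    abel
  have h' : ∀ y : ℍ[ℝ], (l : ℍ[ℝ]) * y = -(y * r) := by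
    intro y
    have h1 := congrArg ((l : ℍ[ℝ]) * ·) (h y)
    simp only [← mul_assoc, hl'] at h1
    rw [h1]
    simp
  have hlr : twist (-l) r = 1 := by
    ext1 y
    refine twist_apply_eq_iff.2 ?_
    rw [Unitary.coe_neg, neg_mul, h', neg_neg]
  exact twist_ne_one (by rw [neg_sq, hl]) hlr

/-- Commuting with the pure unit quaternion r means that the imaginary part of q is parallel to r;
the coefficient b is their inner product. -/
theorem eq_smul_add_smul_of_commute (hr : r ^ 2 = -1) {q : ℍ[ℝ]} (h : q * r = r * q) :
    ∃ a b : ℝ, q = a • 1 + b • (r : ℍ[ℝ]) := by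
  have h0 := UnitQuat.re_eq_zero hr
  have hs := r.sum_sq
  have h₁ := congrArg QuaternionAlgebra.imI h
  have h₂ := congrArg QuaternionAlgebra.imJ h
  have h₃ := congrArg QuaternionAlgebra.imK h
  simp [h0] at h₁ h₂ h₃
  rw [h0] at hs
  refine ⟨q.re, q.imI * (r : ℍ[ℝ]).imI + q.imJ * (r : ℍ[ℝ]).imJ + q.imK * (r : ℍ[ℝ]).imK, ?_⟩
  ext
  · simp [h0]
  · simp
    linear_combination (-q.imI) * hs + (r : ℍ[ℝ]).imJ / 2 * h₃ - (r : ℍ[ℝ]).imK / 2 * h₂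
  · simp
    linear_combination (-q.imJ) * hs + (r : ℍ[ℝ]).imK / 2 * h₁ - (r : ℍ[ℝ]).imI / 2 * h₃
  · simp
    linear_combination (-q.imK) * hs + (r : ℍ[ℝ]).imI / 2 * h₂ - (r : ℍ[ℝ]).imJ / 2 * h₁

theorem mem_fixSpace_zpowers {G : Subgroup O4} {h : G} {x : ℍ[ℝ]} :
    x ∈ fixSpace G (Subgroup.zpowers h) ↔ (h : O4) x = x := by
  constructor
  · intro hx
    exact hx h (Subgroup.mem_zpowers h)
  · intro hx g hg
    have : Subgroup.zpowers h ≤ isotropy G x := by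
      rw [Subgroup.zpowers_le]
      exact hx
    exact this hg

/-- If u is one nonzero fixed vector, x is fixed exactly when u⁻¹x commutes with r, so the fixed
space is u(ℝ + ℝr). -/
theorem finrank_fixSpace_zpowers (hl : l ^ 2 = -1) (hr : r ^ 2 = -1) {G : Subgroup O4} {h : G}
    (hh : (h : O4) = twist l r) :
    Module.finrank ℝ (fixSpace G (Subgroup.zpowers h)) = 2 := by
  obtain ⟨u, hu0, hu⟩ := exists_twist_apply_eq hl hr
  have hu' := twist_apply_eq_iff.1 hu
  have hrr := UnitQuat.coe_mul_self hr
  have hind : LinearIndependent ℝ ![u, u * r] := by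
    rw [LinearIndependent.pair_iff]
    intro s t hst
    have h1 : u * (s • 1 + t • (r : ℍ[ℝ])) = 0 := by
      rw [← hst]
      simp [mul_add]
    have h2 := (mul_eq_zero.1 h1).resolve_left hu0
    have hs : s = 0 := by
      simpa [UnitQuat.re_eq_zero hr] using congrArg QuaternionAlgebra.re h2
    subst hs
    rw [zero_smul, zero_add, smul_eq_zero] at h2
    exact ⟨rfl, h2.resolve_right r.coe_ne_zero⟩
  have hspan : fixSpace G (Subgroup.zpowers h) = Submodule.span ℝ (Set.range ![u, u * r]) := by
    ext x
    rw [mem_fixSpace_zpowers, hh, twist_apply_eq_iff, Matrix.range_cons, Matrix.range_cons,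
      Matrix.range_empty, Set.union_empty, Set.singleton_union, Submodule.mem_span_pair]
    constructor
    · intro hx
      have hx' : u * (u⁻¹ * x * r) = u * (r * (u⁻¹ * x)) := by
        rw [mul_assoc, mul_inv_cancel_left₀ hu0, ← mul_assoc, ← hu', mul_assoc,
          mul_inv_cancel_left₀ hu0, hx]
      obtain ⟨a, b, hab⟩ := eq_smul_add_smul_of_commute hr (mul_left_cancel₀ hu0 hx')
      refine ⟨a, b, ?_⟩
      rw [← mul_inv_cancel_left₀ hu0 x, hab]
      simp [mul_add]
    · rintro ⟨a, b, rfl⟩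
      simp only [mul_add, add_mul, mul_smul_comm, smul_mul_assoc, ← mul_assoc, hu']
  rw [hspan, finrank_span_eq_card hind, Fintype.card_fin]

end Fix

/-! ### Groups whose nontrivial isotropy subgroups are generated by such involutions -/

/-- The nontrivial elements of `G` with a nonzero fixed point are maps `x ↦ l x r̄` with
`l² = r² = -1`, and any nonzero point is fixed by at most one of them. -/
structure IsSimplyReflected (G : Subgroup O4) : Prop where
  neg_mem : twist (-1) 1 ∈ G
  exists_mem : ∃ l r : UnitQuat, l ^ 2 = -1 ∧ r ^ 2 = -1 ∧ twist l r ∈ G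
  exists_eq : ∀ g ∈ G, ∀ x : ℍ[ℝ], x ≠ 0 → g x = x → g ≠ 1 →
    ∃ l r : UnitQuat, l ^ 2 = -1 ∧ r ^ 2 = -1 ∧ g = twist l r
  eq_of_fix : ∀ g ∈ G, ∀ g' ∈ G, ∀ x : ℍ[ℝ], x ≠ 0 → g x = x → g' x = x → g ≠ 1 → g' ≠ 1 → g = g'

namespace IsSimplyReflected

variable {G : Subgroup O4}

theorem isotropy_eq_zpowers (hG : IsSimplyReflected G) {h : G} (h1 : h ≠ 1)
    {x : ℍ[ℝ]} (hx : x ≠ 0) (hhx : (h : O4) x = x) : isotropy G x = Subgroup.zpowers h := by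
  apply le_antisymm
  · intro g hg
    by_cases hg1 : g = 1
    · rw [hg1]
      exact one_mem _
    · have hgh : g = h := Subtype.ext (hG.eq_of_fix g g.2 h h.2 x hx hg hhx
        (fun h' => hg1 (Subtype.ext h')) fun h' => h1 (Subtype.ext h'))
      rw [hgh]
      exact Subgroup.mem_zpowers h
  · rw [Subgroup.zpowers_le]
    exact hhx

theorem sq_eq_one {h : G} {l r : UnitQuat} (hl : l ^ 2 = -1) (hr : r ^ 2 = -1)
    (hh : (h : O4) = twist l r) : h ^ 2 = 1 := by
  apply Subtype.ext
  rw [Subgroup.coe_pow, hh, twist_pow_two_eq_one hl hr]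
  rfl

theorem ne_one {h : G} {l r : UnitQuat} (hl : l ^ 2 = -1) (hh : (h : O4) = twist l r) :
    h ≠ 1 := by
  rintro rfl
  exact twist_ne_one hl hh.symm

theorem orderOf_eq_two {h : G} {l r : UnitQuat} (hl : l ^ 2 = -1) (hr : r ^ 2 = -1)
    (hh : (h : O4) = twist l r) : orderOf h = 2 :=
  orderOf_eq_prime (sq_eq_one hl hr hh) (ne_one hl hh)

theorem mem_nontrivialIsotropy_iff (hG : IsSimplyReflected G) {H : Subgroup G} :
    H ∈ nontrivialIsotropy G ↔ ∃ (h : G) (l r : UnitQuat), l ^ 2 = -1 ∧ r ^ 2 = -1 ∧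
      (h : O4) = twist l r ∧ H = Subgroup.zpowers h := by
  constructor
  · rintro ⟨hne, x, hx, rfl⟩
    obtain ⟨h, hhx, h1⟩ := (isotropy G x).bot_or_exists_ne_one.resolve_left hne
    obtain ⟨l, r, hl, hr, hh⟩ := hG.exists_eq h h.2 x hx hhx fun h' => h1 (Subtype.ext h')
    exact ⟨h, l, r, hl, hr, hh, hG.isotropy_eq_zpowers h1 hx hhx⟩
  · rintro ⟨h, l, r, hl, hr, hh, rfl⟩
    obtain ⟨x, hx, hhx⟩ := exists_twist_apply_eq hl hr
    rw [← hh] at hhx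
    refine ⟨fun h' => ne_one hl hh (Subgroup.zpowers_eq_bot.1 h'), x, hx, ?_⟩
    exact hG.isotropy_eq_zpowers (ne_one hl hh) hx hhx

theorem isotropy_properties (hG : IsSimplyReflected G) : (nontrivialIsotropy G).Nonempty ∧
    (∀ H ∈ nontrivialIsotropy G, Nat.card H = 2 ∧ Module.finrank ℝ (fixSpace G H) = 2) ∧
    ∀ x : ℍ[ℝ], ¬ Odd (Module.finrank ℝ (fixSpace G (isotropy G x))) := by
  have h2 : ∀ H ∈ nontrivialIsotropy G,
      Nat.card H = 2 ∧ Module.finrank ℝ (fixSpace G H) = 2 := by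
    intro H hH
    obtain ⟨h, l, r, hl, hr, hh, rfl⟩ := hG.mem_nontrivialIsotropy_iff.1 hH
    rw [Nat.card_zpowers, orderOf_eq_two hl hr hh]
    exact ⟨rfl, finrank_fixSpace_zpowers hl hr hh⟩
  refine ⟨?_, h2, fun x => ?_⟩
  · obtain ⟨l, r, hl, hr, h⟩ := hG.exists_mem
    exact ⟨_, hG.mem_nontrivialIsotropy_iff.2 ⟨⟨_, h⟩, l, r, hl, hr, rfl, rfl⟩⟩
  -- The dimension is 0 for x = 0, because -1 lies in G; it is 4 for trivial isotropy and 2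
  -- otherwise.
  · by_cases hx : x = 0
    · have hbot : fixSpace G (isotropy G x) = ⊥ := by
        refine (Submodule.eq_bot_iff _).2 fun y hy => ?_
        have hm : (⟨_, hG.neg_mem⟩ : G) ∈ isotropy G x := by
          rw [hx]
          exact map_zero (twist (-1) 1)
        have h3 := twist_apply_eq_iff.1 (hy _ hm)
        simp only [Unitary.coe_neg, OneMemClass.coe_one, neg_mul, one_mul, mul_one] at h3
        have h4 : (2 : ℝ) • y = 0 := by
          rw [two_smul]
          exact add_eq_zero_iff_neg_eq.2 h3
        exact (smul_eq_zero.1 h4).resolve_left two_ne_zero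
      rw [hbot, finrank_bot]
      decide
    · by_cases hb : isotropy G x = ⊥
      · have htop : fixSpace G (isotropy G x) = ⊤ := by
          refine Submodule.eq_top_iff'.2 fun y g hg => ?_
          rw [hb, Subgroup.mem_bot] at hg
          rw [hg]
          rfl
        rw [htop, finrank_top, Quaternion.finrank_eq_four]
        decide
      · rw [(h2 _ ⟨hb, x, hx, rfl⟩).2]
        decide

end IsSimplyReflected

/-! ### Normalizers -/

/-- A description of the normalizer of the group of order two generated by `h`, when the
centralizer of `h` consists of the products of powers of `T` and `h`, and `T` acts on the fixed
plane of `h` as a rotation with respect to the complex structure `K`. -/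
theorem normalizerActsAs_of_centralizer {G : Subgroup O4} {h T : G} {l r : UnitQuat}
    (hl : l ^ 2 = -1) (hr : r ^ 2 = -1) (hh : (h : O4) = twist l r) (K : O4)
    (hKh : ∀ x, (h : O4) x = x → (h : O4) (K x) = K x) (hK : ∀ x, K (K x) = -x) (θ : ℝ)
    (hT : ∀ x, (h : O4) x = x → (T : O4) x = Real.cos θ • x + Real.sin θ • K x)
    (hTh : T * h = h * T)
    (hfree : ∀ (k : ℤ) (x : ℍ[ℝ]), x ≠ 0 → ((T ^ k : G) : O4) x = x → T ^ k = 1)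
    (hgen : ∀ g : G, g * h = h * g → ∃ k : ℤ, g = T ^ k ∨ g = T ^ k * h) :
    NormalizerActsAs G (Subgroup.zpowers h) (Multiplicative (ZMod (orderOf T) × ZMod 2))
      (orderOf T) θ := by
  have h1 := IsSimplyReflected.ne_one hl hh
  have h2 := IsSimplyReflected.sq_eq_one hl hr hh
  have hmem : ∀ n : G, n ∈ normalizerIn G (Subgroup.zpowers h) ↔ n * h = h * n := fun n =>
    mem_normalizer_zpowers_iff h2 h1
  have hfr := finrank_fixSpace_zpowers hl hr hh
  obtain ⟨x₀, hx₀, hhx₀⟩ := exists_twist_apply_eq hl hr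
  rw [← hh] at hhx₀
  let T' : normalizerIn G (Subgroup.zpowers h) := ⟨T, (hmem T).2 hTh⟩
  let h' : normalizerIn G (Subgroup.zpowers h) := ⟨h, (hmem h).2 rfl⟩
  have hgen' : ∀ g : normalizerIn G (Subgroup.zpowers h), ∃ k : ℤ, g = T' ^ k ∨ g = T' ^ k * h' := by
    rintro ⟨g, hg⟩
    obtain ⟨k, hk | hk⟩ := hgen g ((hmem g).1 hg)
    · exact ⟨k, Or.inl (Subtype.ext hk)⟩
    · exact ⟨k, Or.inr (Subtype.ext hk)⟩
  have hoT : orderOf T' = orderOf T := (Subgroup.orderOf_coe T').symm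
  have hoh : orderOf h' = 2 :=
    (Subgroup.orderOf_coe h').symm.trans (IsSimplyReflected.orderOf_eq_two hl hr hh)
  -- Nontrivial powers of T have no nonzero fixed vector, whereas h has one.
  have hnot : h' ∉ Subgroup.zpowers T' := by
    rintro ⟨k, hk⟩
    have hk' : T ^ k = h := congrArg Subtype.val hk
    exact h1 (hk'.symm.trans (hfree k x₀ hx₀ (by rw [hk', hhx₀])))
  have hact : normalizerAction G (Subgroup.zpowers h) h' = 1 := by
    ext1 x
    exact Subtype.ext (mem_fixSpace_zpowers.1 x.2)
  have hrange : (normalizerAction G (Subgroup.zpowers h)).range =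
      Subgroup.zpowers (normalizerAction G (Subgroup.zpowers h) T') := by
    apply le_antisymm
    · rintro _ ⟨g, rfl⟩
      obtain ⟨k, rfl | rfl⟩ := hgen' g
      · rw [map_zpow]
        exact ⟨k, rfl⟩
      · rw [map_mul, map_zpow, hact, mul_one]
        exact ⟨k, rfl⟩
    · rw [Subgroup.zpowers_le]
      exact ⟨T', rfl⟩
  have hord : orderOf (normalizerAction G (Subgroup.zpowers h) T') = orderOf T := by
    apply Nat.dvd_antisymm
    · rw [← hoT]
      exact orderOf_map_dvd _ _
    · apply orderOf_dvd_of_pow_eq_one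
      -- A power of T that is trivial on the plane fixes the nonzero vector x₀, hence is trivial in
      -- G; restriction does not lower the order.
      set k := orderOf (normalizerAction G (Subgroup.zpowers h) T')
      have hk : normalizerAction G (Subgroup.zpowers h) (T' ^ k) = 1 := by
        rw [map_pow]
        exact pow_orderOf_eq_one _
      have hk' : ((T ^ k : G) : O4) x₀ = x₀ := congrArg
        (fun f : fixSpace G (Subgroup.zpowers h) ≃ₗᵢ[ℝ] fixSpace G (Subgroup.zpowers h) =>
          ((f ⟨x₀, mem_fixSpace_zpowers.2 hhx₀⟩ : fixSpace G (Subgroup.zpowers h)) : ℍ[ℝ])) hk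
      have := hfree k x₀ hx₀
      rw [zpow_natCast] at this
      exact this hk'
  refine ⟨?_, ?_, ⟨hfr⟩, ?_⟩
  · rw [← hoT]
    exact nonempty_mulEquiv_zmod_prod (Subtype.ext hTh) hoh hnot hgen'
  · rw [hrange]
    exact ⟨mulEquivOfCyclicCardEq ((Nat.card_zpowers _).trans (hord.trans (Nat.card_zmod _).symm))⟩
  · intro o
    have : Fact (Module.finrank ℝ (fixSpace G (Subgroup.zpowers h)) = 2) := ⟨hfr⟩
    rw [hrange]
    let K' : fixSpace G (Subgroup.zpowers h) →ₗ[ℝ] fixSpace G (Subgroup.zpowers h) :=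
      (K.toLinearEquiv : ℍ[ℝ] →ₗ[ℝ] ℍ[ℝ]).restrict fun x hx =>
        mem_fixSpace_zpowers.2 (hKh x (mem_fixSpace_zpowers.1 hx))
    refine zpowers_eq_zpowers_rotation o _ K' (fun x => Subtype.ext (hK x)) (fun x => K.norm_map x) θ
      fun x => Subtype.ext (hT x (mem_fixSpace_zpowers.1 x.2))

theorem NormalizerActsAs.congr {G : Subgroup O4} {H : Subgroup G} {A B : Type} [Group A] [Group B]
    {n : ℕ} {θ : ℝ} (h : NormalizerActsAs G H A n θ) (e : Nonempty (A ≃* B)) :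
    NormalizerActsAs G H B n θ :=
  ⟨h.1.map2 MulEquiv.trans e, h.2⟩

/-- One-sided multiplications act freely on nonzero vectors, since only 1 is conjugate to 1. -/
theorem twist_zpow_eq_one_of_apply_eq {a b : UnitQuat} (hab : a = 1 ∨ b = 1) (k : ℤ) {x : ℍ[ℝ]}
    (hx : x ≠ 0) (h : (twist a b ^ k) x = x) : twist a b ^ k = 1 := by
  rw [twist_zpow] at h ⊢
  obtain ⟨u, hu⟩ := exists_conj_of_twist_apply_eq hx h
  rcases hab with rfl | rfl
  · rw [one_zpow, eq_comm, conj_eq_one_iff] at hu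
    rw [one_zpow, hu, twist_one]
  · rw [one_zpow, mul_one, mul_inv_cancel] at hu
    rw [one_zpow, hu, twist_one]

/-! ### Binary dihedral relations -/

theorem qj_mul_qe_zpow (n : ℕ) (a : ℤ) : qj * qe n ^ a = qe n ^ (-a) * qj :=
  mul_zpow_eq_zpow_neg_mul (qj_mul_qe n) a

theorem qe_zpow_mul_qj_mul (n : ℕ) (a b : ℤ) :
    qe n ^ a * qj * (qe n ^ b * qj) = -qe n ^ (a - b) := by
  rw [mul_assoc, ← mul_assoc qj, qj_mul_qe_zpow, mul_assoc _ qj, ← sq, qj_sq, mul_neg_one, mul_neg,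
    ← zpow_add, sub_eq_add_neg]

theorem qe_zpow_mul_qj_sq (n : ℕ) (a : ℤ) : (qe n ^ a * qj) ^ 2 = -1 := by
  rw [sq, qe_zpow_mul_qj_mul, sub_self, zpow_zero]

theorem qe_zpow_conj (n : ℕ) (a b : ℤ) :
    qe n ^ a * (qe n ^ b * qj) * (qe n ^ a)⁻¹ = (qe n ^ a) ^ 2 * (qe n ^ b * qj) := by
  rw [← zpow_neg, mul_assoc (qe n ^ a), mul_assoc (qe n ^ b), qj_mul_qe_zpow, neg_neg, sq, mul_assoc,
    ← mul_assoc (qe n ^ b), ← mul_assoc (qe n ^ a) (qe n ^ b), ← zpow_add, ← zpow_add, add_comm]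

theorem neg_qe_zpow {n : ℕ} (hn : n ≠ 0) (a : ℤ) : -qe n ^ a = qe n ^ (n + a) := by
  rw [zpow_add, zpow_natCast, qe_pow_self hn, neg_one_mul]

theorem neg_qe_zpow_mul_qj {n : ℕ} (hn : n ≠ 0) (a : ℤ) :
    -(qe n ^ a * qj) = qe n ^ (n + a) * qj := by
  rw [← neg_mul, neg_qe_zpow hn]

/-- Otherwise j would be a power of e_n and commute with it; as j also inverts e_n, this gives e_n²
= 1, against its order 2n. -/
theorem qe_zpow_ne_mul_qj {n : ℕ} (hn : 2 ≤ n) (a b : ℤ) : qe n ^ a ≠ qe n ^ b * qj := by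
  intro h
  have hj : qj = qe n ^ (a - b) := by
    rw [sub_eq_neg_add, zpow_add, h, ← mul_assoc, ← zpow_add, neg_add_cancel, zpow_zero, one_mul]
  have h1 := qj_mul_qe n
  have hc : Commute (qe n ^ (a - b)) (qe n) := (Commute.refl (qe n)).zpow_left (a - b)
  rw [hj, hc.eq, mul_inv_cancel_right] at h1
  have h2 : qe n ^ 2 = 1 := by
    rw [sq]
    nth_rewrite 1 [h1]
    exact inv_mul_cancel _
  have h3 := orderOf_dvd_of_pow_eq_one h2
  rw [orderOf_qe (by omega)] at h3
  have := Nat.le_of_dvd two_pos h3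
  omega

theorem sq_eq_of_conj {n : ℕ} {a b : ℤ}
    (h : qe n ^ a * (qe n ^ b * qj) * (qe n ^ a)⁻¹ = qe n ^ b * qj) : (qe n ^ a) ^ 2 = 1 := by
  rw [qe_zpow_conj] at h
  exact mul_eq_right.1 h

theorem sq_eq_neg_of_conj {n : ℕ} {a b : ℤ}
    (h : qe n ^ a * (qe n ^ b * qj) * (qe n ^ a)⁻¹ = -(qe n ^ b * qj)) :
    (qe n ^ a) ^ 2 = -1 := by
  rw [qe_zpow_conj, ← neg_one_mul (qe n ^ b * qj)] at h
  exact mul_right_cancel h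

theorem UnitQuat.pow_four_eq_one {x : UnitQuat} (h : x ^ 2 = 1 ∨ x ^ 2 = -1) : x ^ 4 = 1 := by
  rw [show 4 = 2 * 2 from rfl, pow_mul]
  rcases h with h | h <;> rw [h]
  · exact one_pow 2
  · exact neg_one_sq

/-- Let x = e_m^c. Then x² has order dividing both 2 and m, which are coprime for odd m, so x² = 1.
-/
theorem qe_zpow_eq_one_or_neg_one {m : ℕ} (hodd : Odd m) {c : ℤ}
    (h : (qe (2 * m) ^ (2 * c)) ^ 4 = 1) :
    qe (2 * m) ^ (2 * c) = 1 ∨ qe (2 * m) ^ (2 * c) = -1 := by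
  have hm : m ≠ 0 := hodd.pos.ne'
  apply UnitQuat.eq_one_or_neg_one
  rw [qe_two_mul_zpow hm] at h ⊢
  have h2 : ((qe m ^ c) ^ 2) ^ 2 = 1 := by rw [← pow_mul, h]
  have hm' : ((qe m ^ c) ^ 2) ^ m = 1 := by
    have h3 : qe m ^ (2 * m) = 1 := by rw [mul_comm, pow_mul, qe_pow_self hm, neg_one_sq]
    rw [← pow_mul, ← zpow_natCast, ← zpow_mul, mul_comm c, zpow_mul, zpow_natCast, h3, one_zpow]
  have h4 := pow_gcd_eq_one.2 ⟨h2, hm'⟩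
  rwa [(Nat.coprime_two_left.2 hodd : Nat.gcd 2 m = 1), pow_one] at h4

theorem qe_four_zpow_even (d : ℤ) : (qe 4 ^ (2 * d)) ^ 4 = 1 := by
  have h : qi ^ 4 = 1 := UnitQuat.pow_four_eq_one (Or.inr qi_sq)
  rw [qe_four_zpow, ← zpow_natCast, ← zpow_mul, mul_comm d, zpow_mul, zpow_natCast, h, one_zpow]

theorem qe_four_zpow_odd (d : ℤ) : (qe 4 ^ (2 * d + 1)) ^ 4 ≠ 1 := by
  rw [zpow_add, zpow_one, ((Commute.refl (qe 4)).zpow_left _).mul_pow, qe_four_zpow_even, one_mul,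
    qe_pow_self four_ne_zero]
  exact UnitQuat.neg_one_ne_one

theorem UnitQuat.sq_neg_of_conj {l r u : UnitQuat} (h : l = u * r * u⁻¹) :
    l ^ 2 = -1 ↔ r ^ 2 = -1 := by
  rw [h, conj_pow, mul_inv_eq_iff_eq_mul, neg_one_mul, ← mul_neg_one, mul_right_inj]

/-! ### The isotropy subgroups -/

section Types

variable {m p q : ℕ}

/-- A factor containing j squares to -1, and conjugacy passes this to the other factor. Without j,
the right factor is a power of i, so the left one has fourth power 1 and the element is trivial. -/
theorem sq_eq_neg_one_of_fix (hodd : Odd m) {g : O4} (hg : g ∈ genGroup m p q) {x : ℍ[ℝ]}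
    (hx : x ≠ 0) (hgx : g x = x) (h1 : g ≠ 1) :
    ∃ l r : UnitQuat, l ^ 2 = -1 ∧ r ^ 2 = -1 ∧ g = twist l r := by
  obtain ⟨c, d, h | h | h | h⟩ := exists_of_mem_genGroup hodd.pos.ne' hg
  all_goals
    rw [h] at hgx
    obtain ⟨u, hu⟩ := exists_conj_of_twist_apply_eq hx hgx
  · exfalso
    apply h1
    have h4 : (qe (2 * m) ^ (2 * c)) ^ 4 = 1 := by
      rw [hu, conj_pow, qe_four_zpow_even, mul_one, mul_inv_cancel]
    rw [h, twist_eq_one_iff]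
    rcases qe_zpow_eq_one_or_neg_one hodd h4 with h5 | h5
    · rw [h5, eq_comm, conj_eq_one_iff] at hu
      exact Or.inl ⟨h5, hu⟩
    · rw [h5, eq_comm, mul_inv_eq_iff_eq_mul, neg_one_mul, ← mul_neg_one, mul_right_inj] at hu
      exact Or.inr ⟨h5, hu⟩
  · have hr := qe_zpow_mul_qj_sq 4 (2 * d)
    exact ⟨_, _, (UnitQuat.sq_neg_of_conj hu).2 hr, hr, h⟩
  · have hl := qe_zpow_mul_qj_sq (2 * m) (2 * c)
    exact ⟨_, _, hl, (UnitQuat.sq_neg_of_conj hu).1 hl, h⟩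
  · exact ⟨_, _, qe_zpow_mul_qj_sq _ _, qe_zpow_mul_qj_sq _ _, h⟩

theorem qe_zpow_sq_ne_neg_one (hodd : Odd m) (c : ℤ) : (qe (2 * m) ^ (2 * c)) ^ 2 ≠ -1 := by
  intro h
  rcases qe_zpow_eq_one_or_neg_one hodd (UnitQuat.pow_four_eq_one (Or.inr h)) with h' | h' <;>
    rw [h'] at h
  · exact UnitQuat.neg_one_ne_one (by rw [← h, one_pow])
  · exact UnitQuat.neg_one_ne_one (by rw [← h, neg_one_sq])

/-- The elements `x ↦ l x r̄` of `genGroup` with `l² = r² = -1`. -/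
theorem exists_of_sq_eq_neg_one (hodd : Odd m) {g : O4} (hg : g ∈ genGroup m p q)
    {l r : UnitQuat} (hl : l ^ 2 = -1) (hr : r ^ 2 = -1) (h : g = twist l r) :
    ∃ c d : ℤ,
      ((qe (2 * m) ^ (2 * c + p)) ^ 2 = -1 ∧
        g = twist (qe (2 * m) ^ (2 * c + p)) (qe 4 ^ (2 * d) * qj)) ∨
      ((qe 4 ^ (2 * d + q)) ^ 2 = -1 ∧ g = twist (qe (2 * m) ^ (2 * c) * qj) (qe 4 ^ (2 * d + q))) ∨
      g = twist (qe (2 * m) ^ (2 * c + p) * qj) (qe 4 ^ (2 * d + q) * qj) := by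
  have key : ∀ l' r' : UnitQuat, g = twist l' r' → l' ^ 2 = -1 ∧ r' ^ 2 = -1 := by
    intro l' r' h'
    rcases twist_eq_twist_iff.1 (h'.symm.trans h) with ⟨rfl, rfl⟩ | ⟨rfl, rfl⟩
    · exact ⟨hl, hr⟩
    · rw [neg_sq, neg_sq]
      exact ⟨hl, hr⟩
  obtain ⟨c, d, h | h | h | h⟩ := exists_of_mem_genGroup hodd.pos.ne' hg
  · exact absurd (key _ _ h).1 (qe_zpow_sq_ne_neg_one hodd c)
  · exact ⟨c, d, Or.inl ⟨(key _ _ h).1, h⟩⟩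
  · exact ⟨c, d, Or.inr (Or.inl ⟨(key _ _ h).2, h⟩)⟩
  · exact ⟨c, d, Or.inr (Or.inr h)⟩

theorem exists_of_zpow_right (hm : m ≠ 0) {g : O4} (hg : g ∈ genGroup m p q) {l : UnitQuat} {b : ℤ}
    (h : g = twist l (qe 4 ^ b)) :
    ∃ c d : ℤ, g = twist (qe (2 * m) ^ (2 * c)) (qe 4 ^ (2 * d)) ∨
      g = twist (qe (2 * m) ^ (2 * c) * qj) (qe 4 ^ (2 * d + q)) := by
  have key : ∀ (l' : UnitQuat) (b' : ℤ), g ≠ twist l' (qe 4 ^ b' * qj) := by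
    intro l' b' h'
    rcases twist_eq_twist_iff.1 (h.symm.trans h') with ⟨-, h3⟩ | ⟨-, h3⟩
    · exact qe_zpow_ne_mul_qj (by norm_num) _ _ h3
    · rw [neg_qe_zpow_mul_qj four_ne_zero] at h3
      exact qe_zpow_ne_mul_qj (by norm_num) _ _ h3
  obtain ⟨c, d, h | h | h | h⟩ := exists_of_mem_genGroup hm hg
  · exact ⟨c, d, Or.inl h⟩
  · exact absurd h (key _ _)
  · exact ⟨c, d, Or.inr h⟩
  · exact absurd h (key _ _)

theorem exists_of_zpow_left (hm : m ≠ 0) {g : O4} (hg : g ∈ genGroup m p q) {r : UnitQuat} {a : ℤ}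
    (h : g = twist (qe (2 * m) ^ a) r) :
    ∃ c d : ℤ, g = twist (qe (2 * m) ^ (2 * c)) (qe 4 ^ (2 * d)) ∨
      g = twist (qe (2 * m) ^ (2 * c + p)) (qe 4 ^ (2 * d) * qj) := by
  have h2m : 2 * m ≠ 0 := by omega
  have key : ∀ (r' : UnitQuat) (a' : ℤ), g ≠ twist (qe (2 * m) ^ a' * qj) r' := by
    intro r' a' h'
    rcases twist_eq_twist_iff.1 (h.symm.trans h') with ⟨h3, -⟩ | ⟨h3, -⟩
    · exact qe_zpow_ne_mul_qj (by omega) _ _ h3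
    · rw [neg_qe_zpow_mul_qj h2m] at h3
      exact qe_zpow_ne_mul_qj (by omega) _ _ h3
  obtain ⟨c, d, h | h | h | h⟩ := exists_of_mem_genGroup hm hg
  · exact ⟨c, d, Or.inl h⟩
  · exact ⟨c, d, Or.inr h⟩
  · exact absurd h (key _ _)
  · exact absurd h (key _ _)

/-- Odd powers of e_4 are primitive eighth roots of unity. For q = 1 this excludes involutions with
j in the left factor only. -/
theorem qe_four_zpow_odd_sq_ne (d : ℤ) : (qe 4 ^ (2 * d + (1 : ℕ))) ^ 2 ≠ -1 := fun h =>
  qe_four_zpow_odd d (UnitQuat.pow_four_eq_one (Or.inr h))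

theorem eq_one_of_fix_right (hodd : Odd m) {g : O4} (hg : g ∈ genGroup m p 1) {x : ℍ[ℝ]}
    (hx : x ≠ 0) (hgx : g x = x) {l : UnitQuat} {b : ℤ} (h : g = twist l (qe 4 ^ b)) : g = 1 := by
  by_contra h1
  obtain ⟨l', r', hl, hr, h'⟩ := sq_eq_neg_one_of_fix hodd hg hx hgx h1
  have key : ∀ l₁ r₁ : UnitQuat, g = twist l₁ r₁ → l₁ ^ 2 = -1 ∧ r₁ ^ 2 = -1 := by
    intro l₁ r₁ h₁
    rcases twist_eq_twist_iff.1 (h₁.symm.trans h') with ⟨rfl, rfl⟩ | ⟨rfl, rfl⟩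
    · exact ⟨hl, hr⟩
    · rw [neg_sq, neg_sq]
      exact ⟨hl, hr⟩
  obtain ⟨c, d, h | h⟩ := exists_of_zpow_right hodd.pos.ne' hg h
  · exact qe_zpow_sq_ne_neg_one hodd c (key _ _ h).1
  · exact qe_four_zpow_odd_sq_ne d (key _ _ h).2

theorem eq_one_of_fix_left (hodd : Odd m) {g : O4} (hg : g ∈ genGroup m 0 q) {x : ℍ[ℝ]}
    (hx : x ≠ 0) (hgx : g x = x) {r : UnitQuat} {a : ℤ} (h : g = twist (qe (2 * m) ^ a) r) :
    g = 1 := by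
  by_contra h1
  obtain ⟨l', r', hl, hr, h'⟩ := sq_eq_neg_one_of_fix hodd hg hx hgx h1
  have key : ∀ l₁ r₁ : UnitQuat, g = twist l₁ r₁ → l₁ ^ 2 = -1 := by
    intro l₁ r₁ h₁
    rcases twist_eq_twist_iff.1 (h₁.symm.trans h') with ⟨rfl, rfl⟩ | ⟨rfl, rfl⟩
    · exact hl
    · rw [neg_sq, hl]
  obtain ⟨c, d, h | h⟩ := exists_of_zpow_left hodd.pos.ne' hg h
  · exact qe_zpow_sq_ne_neg_one hodd c (key _ _ h)
  · refine qe_zpow_sq_ne_neg_one hodd c ?_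
    simpa using key _ _ h

theorem exists_right_of_sq (hodd : Odd m) {g : O4} (hg : g ∈ genGroup m p 1) {l r : UnitQuat}
    (hl : l ^ 2 = -1) (hr : r ^ 2 = -1) (h : g = twist l r) :
    ∃ (l' : UnitQuat) (b : ℤ), g = twist l' (qe 4 ^ b * qj) := by
  obtain ⟨c, d, ⟨-, h⟩ | ⟨h, -⟩ | h⟩ := exists_of_sq_eq_neg_one hodd hg hl hr h
  · exact ⟨_, _, h⟩
  · exact absurd h (qe_four_zpow_odd_sq_ne d)
  · exact ⟨_, _, h⟩

theorem exists_left_of_sq (hodd : Odd m) {g : O4} (hg : g ∈ genGroup m 0 q) {l r : UnitQuat}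
    (hl : l ^ 2 = -1) (hr : r ^ 2 = -1) (h : g = twist l r) :
    ∃ (r' : UnitQuat) (a : ℤ), g = twist (qe (2 * m) ^ a * qj) r' := by
  obtain ⟨c, d, ⟨h, -⟩ | ⟨-, h⟩ | h⟩ := exists_of_sq_eq_neg_one hodd hg hl hr h
  · exact absurd (by simpa using h) (qe_zpow_sq_ne_neg_one hodd c)
  · exact ⟨_, _, h⟩
  · exact ⟨_, _, h⟩

theorem isSimplyReflected_genGroup (hodd : Odd m) (hpq : p = 0 ∨ q = 1) :
    IsSimplyReflected (genGroup m p q) where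
  neg_mem := by
    have h := twist_qe_mem m p q m
    rwa [zpow_natCast, qe_pow_self hodd.pos.ne'] at h
  exists_mem := by
    have h := (genGroup m p q).mul_mem (twist_one_qj_mem m p q) (twist_qj_one_mem m p q)
    rw [twist_mul, ← zpow_natCast, ← zpow_natCast, qj_mul_qe_zpow] at h
    exact ⟨_, _, qe_zpow_mul_qj_sq _ _, qe_zpow_mul_qj_sq _ _, h⟩
  exists_eq g hg x hx hgx h1 := sq_eq_neg_one_of_fix hodd hg hx hgx h1
  eq_of_fix g hg g' hg' x hx hgx hgx' h1 h1' := by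
    obtain ⟨l, r, hl, hr, h⟩ := sq_eq_neg_one_of_fix hodd hg hx hgx h1
    obtain ⟨l', r', hl', hr', h'⟩ := sq_eq_neg_one_of_fix hodd hg' hx hgx' h1'
    have hfix : (g * g') x = x := by
      change g (g' x) = x
      rw [hgx', hgx]
    -- Both involutions contain j in their left factors (p = 0) or in their right factors (q = 1).
    -- It disappears from that factor of the product, which still fixes x and hence is trivial.
    have hone : g * g' = 1 := by
      rcases hpq with rfl | rfl
      · obtain ⟨r₁, a, e₁⟩ := exists_left_of_sq hodd hg hl hr h
        obtain ⟨r₂, a', e₂⟩ := exists_left_of_sq hodd hg' hl' hr' h'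
        refine eq_one_of_fix_left hodd (mul_mem hg hg') hx hfix (r := r₁ * r₂)
          (a := (2 * m : ℕ) + (a - a')) ?_
        rw [e₁, e₂, twist_mul, qe_zpow_mul_qj_mul, neg_qe_zpow (by have := hodd.pos; omega)]
      · obtain ⟨l₁, a, e₁⟩ := exists_right_of_sq hodd hg hl hr h
        obtain ⟨l₂, a', e₂⟩ := exists_right_of_sq hodd hg' hl' hr' h'
        refine eq_one_of_fix_right hodd (mul_mem hg hg') hx hfix (l := l₁ * l₂)
          (b := (4 : ℕ) + (a - a')) ?_
        rw [e₁, e₂, twist_mul, qe_zpow_mul_qj_mul, neg_qe_zpow four_ne_zero]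
    have hg2 : g * g = 1 := by rw [← sq, h, twist_pow_two_eq_one hl hr]
    exact mul_left_cancel (hg2.trans hone.symm)

end Types

/-! ### The normalizers -/

theorem conj_eq_of_commute {l r l' r' : UnitQuat}
    (h : twist l' r' * twist l r = twist l r * twist l' r') :
    (l' * l * l'⁻¹ = l ∧ r' * r * r'⁻¹ = r) ∨ (l' * l * l'⁻¹ = -l ∧ r' * r * r'⁻¹ = -r) := by
  rw [← twist_eq_twist_iff, ← twist_conj, h, mul_inv_cancel_right]

theorem orderOf_twist_left (a : UnitQuat) : orderOf (twist a 1) = orderOf a := by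
  rw [orderOf_eq_orderOf_iff]
  intro n
  rw [twist_pow, one_pow, twist_eq_one_iff]
  simp [UnitQuat.neg_one_ne_one.symm]

theorem orderOf_twist_right (a : UnitQuat) : orderOf (twist 1 a) = orderOf a := by
  rw [orderOf_eq_orderOf_iff]
  intro n
  rw [twist_pow, one_pow, twist_eq_one_iff]
  simp [UnitQuat.neg_one_ne_one.symm]

theorem apply_apply_of_commute {h K : O4} (hc : h * K = K * h) {x : ℍ[ℝ]} (hx : h x = x) :
    h (K x) = K x := by
  change (h * K) x = K x
  rw [hc]
  exact congrArg K hx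

theorem twist_neg_one_one_apply (x : ℍ[ℝ]) : twist (-1) 1 x = -x := by
  rw [twist_apply, Unitary.coe_neg]
  simp

theorem twist_twist_apply_of_sq {l r : UnitQuat} (h : twist l r ^ 2 = twist (-1) 1) (x : ℍ[ℝ]) :
    twist l r (twist l r x) = -x := by
  rw [← twist_neg_one_one_apply, ← h, sq]
  rfl

/-- It suffices to examine the elements of the centralizer up to multiplication by `h`. -/
theorem exists_zpow_of_mul {Γ : Type*} [Group Γ] {T h g : Γ} (h2 : h ^ 2 = 1) {k : ℤ}
    (hg : g * h = T ^ k) : g = T ^ k * h := by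
  rw [← hg, mul_assoc, ← sq, h2, mul_one]

section Normalizers

variable {m p q : ℕ}

theorem orderOf_neg_one : orderOf (-1 : UnitQuat) = 2 :=
  orderOf_eq_prime neg_one_sq UnitQuat.neg_one_ne_one

/-- Elements of the centralizer of `x ↦ l x r̄`, `r = e₄^b j`, whose right factor is a power of
`e₄`. -/
theorem centralizer_right (hm : m ≠ 0) {l : UnitQuat} {b : ℤ} {g : O4} (hg : g ∈ genGroup m p 1)
    (hc : g * twist l (qe 4 ^ b * qj) = twist l (qe 4 ^ b * qj) * g) {l' : UnitQuat} {b' : ℤ}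
    (h : g = twist l' (qe 4 ^ b')) :
    ∃ c d : ℤ, g = twist (qe (2 * m) ^ (2 * c)) (qe 4 ^ (2 * d)) := by
  obtain ⟨c, d, h | h⟩ := exists_of_zpow_right hm hg h
  · exact ⟨c, d, h⟩
  · exfalso
    rw [h] at hc
    refine qe_four_zpow_odd d (UnitQuat.pow_four_eq_one ?_)
    rcases conj_eq_of_commute hc with ⟨-, h3⟩ | ⟨-, h3⟩
    · exact Or.inl (sq_eq_of_conj h3)
    · exact Or.inr (sq_eq_neg_of_conj h3)

/-- In a group with `q = 1`, an element of the centralizer of `h` or its product with `h` has a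
power of `e₄` as right factor. -/
theorem centralizer_reduction (hm : m ≠ 0) {h T : genGroup m p 1} {l : UnitQuat} {b : ℤ}
    (hh : (h : O4) = twist l (qe 4 ^ b * qj)) (h2 : h ^ 2 = 1)
    (hgen : ∀ g : genGroup m p 1, g * h = h * g → ∀ c d : ℤ,
      (g : O4) = twist (qe (2 * m) ^ (2 * c)) (qe 4 ^ (2 * d)) → ∃ k : ℤ, g = T ^ k)
    (g : genGroup m p 1) (hc : g * h = h * g) : ∃ k : ℤ, g = T ^ k ∨ g = T ^ k * h := by
  have main : ∀ g : genGroup m p 1, g * h = h * g → ∀ (l' : UnitQuat) (b' : ℤ),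
      (g : O4) = twist l' (qe 4 ^ b') → ∃ k : ℤ, g = T ^ k := by
    intro g hc l' b' hg
    obtain ⟨c, d, hcd⟩ := centralizer_right hm g.2
      (by rw [← hh]; exact congrArg Subtype.val hc) hg
    exact hgen g hc c d hcd
  have hmul : ∀ (l' : UnitQuat) (b' : ℤ), (g : O4) = twist l' (qe 4 ^ b' * qj) →
      ∃ k : ℤ, g = T ^ k ∨ g = T ^ k * h := by
    intro l' b' hg
    obtain ⟨k, hk⟩ := main (g * h) (by rw [hc, mul_assoc, hc]) (l' * l) ((4 : ℕ) + (b' - b))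
      (by rw [Subgroup.coe_mul, hg, hh, twist_mul, qe_zpow_mul_qj_mul, neg_qe_zpow four_ne_zero])
    exact ⟨k, Or.inr (exists_zpow_of_mul h2 hk)⟩
  obtain ⟨c, d, hg | hg | hg | hg⟩ := exists_of_mem_genGroup hm g.2
  · exact (main g hc _ _ hg).imp fun k hk => Or.inl hk
  · exact hmul _ _ hg
  · exact (main g hc _ _ hg).imp fun k hk => Or.inl hk
  · exact hmul _ _ hg

/-- Here T = -1. A commuting pair (e_m^c, i^d) conjugates both factors of h with a common sign. A
minus sign would need (e_m^c)² = -1, impossible for odd m, so both entries are ±1. -/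
theorem normalizerActsAs_dihedral (hodd : Odd m) {h : genGroup m p 1} {a b : ℤ}
    (hh : (h : O4) = twist (qe (2 * m) ^ a * qj) (qe 4 ^ b * qj)) :
    NormalizerActsAs (genGroup m p 1) (Subgroup.zpowers h) (DihedralGroup 2) 2 Real.pi := by
  have hm := hodd.pos.ne'
  have hl := qe_zpow_mul_qj_sq (2 * m) a
  have hr := qe_zpow_mul_qj_sq 4 b
  set l := qe (2 * m) ^ a * qj with hldef
  have h2 := IsSimplyReflected.sq_eq_one hl hr hh
  let T : genGroup m p 1 := ⟨_, (isSimplyReflected_genGroup (p := p) hodd (Or.inr rfl)).neg_mem⟩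
  have hord : orderOf T = 2 := by
    rw [← Subgroup.orderOf_coe, orderOf_twist_left, orderOf_neg_one]
  have key := normalizerActsAs_of_centralizer (T := T) hl hr hh (twist l 1)
    (fun x hx => apply_apply_of_commute (by rw [hh, twist_mul, twist_mul, one_mul, mul_one]) hx)
    (twist_twist_apply_of_sq (by rw [twist_pow, hl, one_pow])) Real.pi
    (fun x _ => by simp [T, twist_neg_one_one_apply])
    (Subtype.ext (by simp only [T, Subgroup.coe_mul, hh, twist_mul, neg_one_mul, mul_neg_one,
      one_mul, mul_one]))
    (fun k x hx hk => Subtype.ext (by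
      rw [Subgroup.coe_zpow] at hk ⊢
      exact twist_zpow_eq_one_of_apply_eq (Or.inr rfl) k hx hk))
    (centralizer_reduction hm hh h2 fun g hc c d hg => by
      have hc' : (g : O4) * h = h * g := congrArg Subtype.val hc
      rw [hg, hh] at hc'
      have h4 : (qe (2 * m) ^ (2 * c)) ^ 4 = 1 := by
        apply UnitQuat.pow_four_eq_one
        rcases conj_eq_of_commute hc' with ⟨h3, -⟩ | ⟨h3, -⟩
        · exact Or.inl (sq_eq_of_conj h3)
        · exact Or.inr (sq_eq_neg_of_conj h3)
      have hL := qe_zpow_eq_one_or_neg_one hodd h4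
      have hR : qe 4 ^ (2 * d) = 1 ∨ qe 4 ^ (2 * d) = -1 := by
        apply UnitQuat.eq_one_or_neg_one
        rcases conj_eq_of_commute hc' with ⟨-, h3⟩ | ⟨h3, -⟩
        · exact sq_eq_of_conj h3
        · exact absurd (sq_eq_neg_of_conj h3) (qe_zpow_sq_ne_neg_one hodd c)
      have hT0 : (g : O4) = twist 1 1 → ∃ k : ℤ, g = T ^ k := fun h' =>
        ⟨0, Subtype.ext (by rw [h', twist_one]; rfl)⟩
      have hT1 : (g : O4) = twist (-1) 1 → ∃ k : ℤ, g = T ^ k := fun h' =>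
        ⟨1, Subtype.ext (by rw [h', zpow_one])⟩
      rcases hL with hL | hL <;> rcases hR with hR | hR <;> rw [hL, hR] at hg
      · exact hT0 hg
      · exact hT1 (by rw [hg, ← twist_neg_left])
      · exact hT1 hg
      · exact hT0 (by rw [hg, twist_neg_neg]))
  rw [hord] at key
  exact key.congr IsKleinFour.nonempty_mulEquiv

/-- The left factor i commutes with every power of e_m, so only the right entry i^d is constrained,
to ±1. The centralizer is therefore generated by h and left multiplication by e_m, which includes -1
= e_m^m. -/
theorem normalizerActsAs_cyclic (hodd : Odd m) {h : genGroup m p 1} {b : ℤ}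
    (hh : (h : O4) = twist qi (qe 4 ^ b * qj)) :
    NormalizerActsAs (genGroup m p 1) (Subgroup.zpowers h)
      (Multiplicative (ZMod (2 * m) × ZMod 2)) (2 * m) (Real.pi / m) := by
  have hm := hodd.pos.ne'
  have hr := qe_zpow_mul_qj_sq 4 b
  have h2 := IsSimplyReflected.sq_eq_one qi_sq hr hh
  let T : genGroup m p 1 := ⟨_, twist_qe_mem m p 1 1⟩
  have hT : (T : O4) = twist (qe m) 1 := by
    simp only [T, zpow_one]
  have hord : orderOf T = 2 * m := by
    rw [← Subgroup.orderOf_coe, hT, orderOf_twist_left, orderOf_qe hm]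
  have hcomm : Commute qi (qe m) := by
    rw [← qe_two_mul_pow hm, ← qe_two_mul_sq hm]
    exact (Commute.refl _).pow_pow _ _
  have key := normalizerActsAs_of_centralizer (T := T) qi_sq hr hh (twist qi 1)
    (fun x hx => apply_apply_of_commute (by rw [hh, twist_mul, twist_mul, one_mul, mul_one]) hx)
    (twist_twist_apply_of_sq (by rw [twist_pow, qi_sq, one_pow])) (Real.pi / m)
    (fun x _ => by
      have hq : (qe m : ℍ[ℝ]) = Real.cos (Real.pi / m) • (1 : ℍ[ℝ]) +
          Real.sin (Real.pi / m) • (qi : ℍ[ℝ]) := by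
        ext <;> simp [qe, qi]
      rw [hT, twist_apply, twist_apply, hq]
      simp [add_mul])
    (Subtype.ext (by simp only [hT, Subgroup.coe_mul, hh, twist_mul, hcomm.eq, one_mul, mul_one]))
    (fun k x hx hk => Subtype.ext (by
      rw [Subgroup.coe_zpow, hT] at hk ⊢
      exact twist_zpow_eq_one_of_apply_eq (Or.inr rfl) k hx hk))
    (centralizer_reduction hm hh h2 fun g hc c d hg => by
      have hc' : (g : O4) * h = h * g := congrArg Subtype.val hc
      rw [hg, hh] at hc'
      have hci : Commute (qe (2 * m) ^ (2 * c)) qi := by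
        rw [← qe_two_mul_pow hm]
        exact ((Commute.refl _).zpow_left _).pow_right _
      have hR : qe 4 ^ (2 * d) = 1 ∨ qe 4 ^ (2 * d) = -1 := by
        apply UnitQuat.eq_one_or_neg_one
        rcases conj_eq_of_commute hc' with ⟨-, h3⟩ | ⟨h3, -⟩
        · exact sq_eq_of_conj h3
        · rw [hci.eq, mul_inv_cancel_right, ← neg_one_mul] at h3
          exact absurd (mul_eq_right.1 h3.symm) UnitQuat.neg_one_ne_one
      have hpow : ∀ k : ℤ, (g : O4) = twist (qe m ^ k) 1 → ∃ k : ℤ, g = T ^ k := fun k h' =>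
        ⟨k, Subtype.ext (by rw [Subgroup.coe_zpow, hT, h', twist_zpow, one_zpow])⟩
      rw [qe_two_mul_zpow hm] at hg
      rcases hR with hR | hR <;> rw [hR] at hg
      · exact hpow c hg
      · exact hpow (m + c) (by rw [hg, ← twist_neg_left, neg_qe_zpow hm]))
  rwa [hord] at key

/-- Two commuting square roots of -1 have a product of square 1, that is ±1, so they agree up to
inversion. -/
theorem exists_zpow_of_commute {r r' : UnitQuat} (hr : r ^ 2 = -1) (hr' : r' ^ 2 = 1 ∨ r' ^ 2 = -1)
    (hc : Commute r' r) : ∃ k : ℤ, r' = r ^ k := by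
  rcases hr' with h | h
  · rcases UnitQuat.eq_one_or_neg_one h with h' | h'
    · exact ⟨0, by rw [h', zpow_zero]⟩
    · exact ⟨2, by rw [h', zpow_ofNat, hr]⟩
  · have h2 : (r' * r) ^ 2 = 1 := by
      rw [hc.mul_pow, h, hr, neg_mul_neg, one_mul]
    rcases UnitQuat.eq_one_or_neg_one h2 with h' | h'
    · exact ⟨-1, by rw [zpow_neg_one, eq_inv_of_mul_eq_one_left h']⟩
    · refine ⟨1, ?_⟩
      rw [zpow_one]
      apply mul_right_cancel (b := r)
      rw [h', ← sq, hr]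

/-- The right factors of the group form the quaternion group of order eight, in which the
centralizer of r is ⟨r⟩; the left entry is ±1 as before, and its sign is absorbed by r² = -1. So T
is `twist 1 r`. -/
theorem normalizerActsAs_quarter (hodd : Odd m) {h : genGroup m 0 0} {a : ℤ} {r : UnitQuat}
    (hr : r ^ 2 = -1) (hrm : twist 1 r ∈ genGroup m 0 0)
    (hh : (h : O4) = twist (qe (2 * m) ^ a * qj) r) :
    NormalizerActsAs (genGroup m 0 0) (Subgroup.zpowers h)
      (Multiplicative (ZMod 4 × ZMod 2)) 4 (Real.pi / 2) := by
  have hm := hodd.pos.ne'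
  have hl := qe_zpow_mul_qj_sq (2 * m) a
  have h2 := IsSimplyReflected.sq_eq_one hl hr hh
  let T : genGroup m 0 0 := ⟨_, hrm⟩
  have hr1 : r ^ 2 ^ 1 ≠ 1 := by
    rw [pow_one, hr]
    exact UnitQuat.neg_one_ne_one
  have hord : orderOf T = 4 := by
    rw [← Subgroup.orderOf_coe, orderOf_twist_right,
      orderOf_eq_prime_pow (p := 2) (n := 1) hr1 (UnitQuat.pow_four_eq_one (Or.inr hr))]
    norm_num
  have main : ∀ g : genGroup m 0 0, g * h = h * g → ∀ (a' : ℤ) (r' : UnitQuat),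
      (g : O4) = twist (qe (2 * m) ^ a') r' → ∃ k : ℤ, g = T ^ k := by
    intro g hc a' r' hg
    have hc0 : (g : O4) * h = h * g := congrArg Subtype.val hc
    have key : ∀ (c : ℤ) (r' : UnitQuat), (r' ^ 2 = 1 ∨ r' ^ 2 = -1) →
        (g : O4) = twist (qe (2 * m) ^ (2 * c)) r' → ∃ k : ℤ, g = T ^ k := by
      intro c r' hr' hg
      have hc' := hc0
      rw [hg, hh] at hc'
      obtain ⟨h5, h6⟩ : (qe (2 * m) ^ (2 * c)) ^ 2 = 1 ∧ r' * r * r'⁻¹ = r := by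
        rcases conj_eq_of_commute hc' with ⟨h3, h4⟩ | ⟨h3, -⟩
        · exact ⟨sq_eq_of_conj h3, h4⟩
        · exact absurd (sq_eq_neg_of_conj h3) (qe_zpow_sq_ne_neg_one hodd c)
      obtain ⟨k, hk⟩ := exists_zpow_of_commute hr hr' (mul_inv_eq_iff_eq_mul.1 h6)
      rcases UnitQuat.eq_one_or_neg_one h5 with h7 | h7 <;> rw [h7, hk] at hg
      · exact ⟨k, Subtype.ext (by rw [hg, Subgroup.coe_zpow, twist_zpow, one_zpow])⟩
      · refine ⟨2 + k, Subtype.ext ?_⟩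
        rw [hg, Subgroup.coe_zpow, twist_zpow, one_zpow, twist_neg_left, zpow_add, zpow_ofNat, hr,
          neg_one_mul]
    obtain ⟨c, d, hg | hg⟩ := exists_of_zpow_left hm g.2 hg
    · refine key c _ ?_ hg
      have h4 := qe_four_zpow_even d
      rw [show 4 = 2 * 2 from rfl, pow_mul] at h4
      exact UnitQuat.eq_one_or_neg_one h4
    · exact key c _ (Or.inr (qe_zpow_mul_qj_sq _ _)) (by simpa using hg)
  have hgen : ∀ g : genGroup m 0 0, g * h = h * g → ∃ k : ℤ, g = T ^ k ∨ g = T ^ k * h := by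
    intro g hc
    have hmul : ∀ (a' : ℤ) (r' : UnitQuat), (g : O4) = twist (qe (2 * m) ^ a' * qj) r' →
        ∃ k : ℤ, g = T ^ k ∨ g = T ^ k * h := by
      intro a' r' hg
      obtain ⟨k, hk⟩ := main (g * h) (by rw [hc, mul_assoc, hc]) ((2 * m : ℕ) + (a' - a)) (r' * r)
        (by rw [Subgroup.coe_mul, hg, hh, twist_mul, qe_zpow_mul_qj_mul, neg_qe_zpow (by omega)])
      exact ⟨k, Or.inr (exists_zpow_of_mul h2 hk)⟩
    obtain ⟨c, d, hg | hg | hg | hg⟩ := exists_of_mem_genGroup hm g.2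
    · exact (main g hc _ _ hg).imp fun k hk => Or.inl hk
    · exact (main g hc _ _ hg).imp fun k hk => Or.inl hk
    · exact hmul _ _ hg
    · exact hmul _ _ hg
  have key := normalizerActsAs_of_centralizer (T := T) hl hr hh (twist 1 r)
    (fun x hx => apply_apply_of_commute (by rw [hh, twist_mul, twist_mul, one_mul, mul_one]) hx)
    (twist_twist_apply_of_sq (by rw [twist_pow, hr, one_pow, ← twist_neg_left]))
    (Real.pi / 2) (fun x _ => by simp [T])
    (Subtype.ext (by simp only [T, Subgroup.coe_mul, hh, twist_mul, one_mul, mul_one]))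
    (fun k x hx hk => Subtype.ext (by
      rw [Subgroup.coe_zpow] at hk ⊢
      exact twist_zpow_eq_one_of_apply_eq (Or.inl rfl) k hx hk)) hgen
  rwa [hord] at key

end Normalizers

/-! ### Conjugacy -/

/-- The maps `a` and `b` are conjugate by an element of `G`. -/
def ConjIn (G : Subgroup O4) (a b : O4) : Prop := ∃ w ∈ G, w * a * w⁻¹ = b

namespace ConjIn

variable {G : Subgroup O4} {a b c : O4}

theorem refl (a : O4) : ConjIn G a a := ⟨1, G.one_mem, by simp⟩

theorem symm (h : ConjIn G a b) : ConjIn G b a := by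
  obtain ⟨w, hw, rfl⟩ := h
  exact ⟨w⁻¹, G.inv_mem hw, by group⟩

theorem trans (h : ConjIn G a b) (h' : ConjIn G b c) : ConjIn G a c := by
  obtain ⟨w, hw, rfl⟩ := h
  obtain ⟨w', hw', rfl⟩ := h'
  exact ⟨w' * w, G.mul_mem hw' hw, by group⟩

theorem of_step {f : ℤ → O4} {w : O4} (hw : w ∈ G) (hf : ∀ d, w * f d * w⁻¹ = f (d + 1))
    (d e : ℤ) : ConjIn G (f d) (f e) := by
  have h0 : ∀ d, ConjIn G (f 0) (f d) := by
    intro d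
    induction d using Int.induction_on with
    | zero => exact refl _
    | succ n ih => exact ih.trans ⟨w, hw, hf n⟩
    | pred n ih =>
      refine ih.trans (symm ⟨w, hw, ?_⟩)
      rw [hf, sub_add_cancel]
  exact (h0 d).symm.trans (h0 e)

theorem isConj_iff {h h' : G} : IsConj h h' ↔ ConjIn G h h' := by
  rw [_root_.isConj_iff]
  constructor
  · rintro ⟨w, hw⟩
    exact ⟨w, w.2, congrArg Subtype.val hw⟩
  · rintro ⟨w, hw, h⟩
    exact ⟨⟨w, hw⟩, Subtype.ext h⟩

theorem conjClass_eq {h h' : G} (hc : ConjIn G h h') :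
    conjClass (Subgroup.zpowers h) = conjClass (Subgroup.zpowers h') := by
  obtain ⟨g, rfl⟩ := _root_.isConj_iff.1 (isConj_iff.2 hc)
  rw [← map_conj_zpowers, conjClass_map]

theorem of_conjClass_eq {h h' : G} {l r l' r' : UnitQuat} (hl : l ^ 2 = -1) (hr : r ^ 2 = -1)
    (hl' : l' ^ 2 = -1) (hh : (h : O4) = twist l r) (hh' : (h' : O4) = twist l' r')
    (hc : conjClass (Subgroup.zpowers h) = conjClass (Subgroup.zpowers h')) :
    ConjIn G (twist l r) (twist l' r') := by
  rw [← hh, ← hh']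
  exact isConj_iff.1 ((conjClass_zpowers_eq_iff (IsSimplyReflected.sq_eq_one hl hr hh)
    (IsSimplyReflected.ne_one hl' hh')).1 hc)

end ConjIn

theorem qj_conj (n : ℕ) (a : ℤ) : qj * qe n ^ a * qj⁻¹ = qe n ^ (-a) := by
  rw [qj_mul_qe_zpow, mul_inv_cancel_right]

theorem qi_inv : qi⁻¹ = -qi := by
  rw [inv_eq_iff_mul_eq_one, mul_neg, ← sq, qi_sq, neg_neg]

theorem qi_conj {n : ℕ} {k : ℕ} (hk : qe n ^ k = qi) {x : UnitQuat} {a : ℤ}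
    (hx : x = qe n ^ a ∨ x = qe n ^ a * qj) : x * qi * x⁻¹ = qi ∨ x * qi * x⁻¹ = -qi := by
  have hc : Commute (qe n ^ a) qi := by
    rw [← hk]
    exact ((Commute.refl _).zpow_left _).pow_right _
  rcases hx with rfl | rfl
  · left
    rw [hc.eq, mul_inv_cancel_right]
  · right
    have h : qj * qi * qj⁻¹ = qi⁻¹ := by
      rw [← hk, ← zpow_natCast, qj_conj, zpow_neg]
    calc qe n ^ a * qj * qi * (qe n ^ a * qj)⁻¹
        = qe n ^ a * (qj * qi * qj⁻¹) * (qe n ^ a)⁻¹ := by group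
      _ = -qi := by rw [h, hc.inv_right.eq, mul_inv_cancel_right, qi_inv]

/-! ### Conjugacy of the involutions inside each group. -/

section Classes

variable {m p q : ℕ}

theorem conjIn_left (hm : m ≠ 0) (a : ℤ) (r : UnitQuat) (d e : ℤ) :
    ConjIn (genGroup m p q) (twist (qe (2 * m) ^ (4 * d + a) * qj) r)
      (twist (qe (2 * m) ^ (4 * e + a) * qj) r) := by
  refine ConjIn.of_step (f := fun d => twist (qe (2 * m) ^ (4 * d + a) * qj) r)
    (twist_qe_mem m p q 1) (fun d => ?_) d e
  rw [twist_conj, ← qe_two_mul_zpow hm, qe_zpow_conj, ← mul_assoc, ← zpow_natCast, ← zpow_mul,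
    ← zpow_add]
  simp only [one_mul, inv_one, mul_one]
  congr 3
  push_cast
  ring

/-- The left factor can be normalized by conjugation, up to a sign. -/
theorem conjIn_left_normalize (hodd : Odd m) (a c c' : ℤ) (r : UnitQuat) :
    ConjIn (genGroup m p q) (twist (qe (2 * m) ^ (2 * c + a) * qj) r)
        (twist (qe (2 * m) ^ (2 * c' + a) * qj) r) ∨
      ConjIn (genGroup m p q) (twist (qe (2 * m) ^ (2 * c + a) * qj) r)
        (twist (qe (2 * m) ^ (2 * c' + a) * qj) (-r)) := by
  have hm := hodd.pos.ne'
  have key : ∀ (c : ℤ) (r : UnitQuat), Even (c - c') →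
      ConjIn (genGroup m p q) (twist (qe (2 * m) ^ (2 * c + a) * qj) r)
        (twist (qe (2 * m) ^ (2 * c' + a) * qj) r) := by
    rintro c r ⟨k, hk⟩
    have h := conjIn_left (p := p) (q := q) hm (2 * c' + a) r k 0
    rwa [show 4 * k + (2 * c' + a) = 2 * c + a by linarith, mul_zero, zero_add] at h
  rcases Int.even_or_odd (c - c') with h | h
  · exact Or.inl (key c r h)
  · right
    -- Conjugation by e_m changes c by 2 only. As m is odd, -1 = e_{2m}^{2m} changes its parity, and
    -- the sign moves to the right factor.
    have h' : Even (m + c - c') := by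
      rw [add_sub_assoc]
      exact ((Int.odd_coe_nat m).2 hodd).add_odd h
    have h'' := key (m + c) (-r) h'
    rw [show 2 * ((m : ℤ) + c) + a = (2 * m : ℕ) + (2 * c + a) by push_cast; ring,
      ← neg_qe_zpow_mul_qj (by omega), twist_neg_neg] at h''
    exact h''

theorem zpow_eq_qi_or_neg {n k : ℕ} (hk : qe n ^ k = qi) {a : ℤ} (h : (qe n ^ a) ^ 2 = -1) :
    qe n ^ a = qi ∨ qe n ^ a = -qi := by
  have hc : Commute (qe n ^ a) qi := by
    rw [← hk]
    exact ((Commute.refl _).zpow_left _).pow_right _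
  have h2 : (qe n ^ a * qi) ^ 2 = 1 := by
    rw [hc.mul_pow, h, qi_sq, neg_mul_neg, one_mul]
  rcases UnitQuat.eq_one_or_neg_one h2 with h' | h'
  · right
    rw [← qi_inv, eq_inv_of_mul_eq_one_left h']
  · left
    apply mul_right_cancel (b := qi)
    rw [h', ← sq, qi_sq]

/-- Conjugation by this element shifts the exponent of e_4 in a right factor e_4^b j by 6. When the
left factor changes sign, as i and ij do, cancelling that sign turns 6 into a shift by 2. -/
theorem twist_qj_qi_mem (m p : ℕ) : twist qj (qe 4 ^ (3 : ℤ)) ∈ genGroup m p 1 := by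
  refine twist_mem_of_eq_mul (twist_qi_mem m p 1 1) (twist_qj_one_mem m p 1) (one_mul _).symm ?_
  rw [← qe_four_zpow, pow_one, ← zpow_add_one]
  rfl

theorem neg_qe_four_zpow_mul_qj (a : ℤ) : -(qe 4 ^ a * qj) = qe 4 ^ (a + 4) * qj := by
  rw [neg_qe_zpow_mul_qj four_ne_zero, add_comm]
  rfl

theorem conjIn_G₁ (hodd : Odd m) {g : O4} (hg : g ∈ genGroup m 0 1) {l r : UnitQuat}
    (hl : l ^ 2 = -1) (hr : r ^ 2 = -1) (h : g = twist l r) :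
    ConjIn (genGroup m 0 1) g (twist qj (qe 4 ^ (1 : ℤ) * qj)) := by
  have hstep : ∀ d : ℤ, ConjIn (genGroup m 0 1) (twist qj (qe 4 ^ (2 * d + 1) * qj))
      (twist qj (qe 4 ^ (1 : ℤ) * qj)) := by
    intro d
    have h := ConjIn.of_step (f := fun d : ℤ => twist qj (qe 4 ^ (2 * d + 1) * qj))
      (twist_qj_one_mem m 0 1) (fun d => ?_) d 0
    · simpa using h
    · rw [twist_conj, mul_inv_cancel_right, ← zpow_natCast, qe_zpow_conj, ← mul_assoc,
        ← zpow_natCast, ← zpow_mul, ← zpow_add]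
      congr 3
      push_cast
      ring
  obtain ⟨c, d, ⟨h, -⟩ | ⟨h, -⟩ | rfl⟩ := exists_of_sq_eq_neg_one hodd hg hl hr h
  · exact absurd (by simpa using h) (qe_zpow_sq_ne_neg_one hodd c)
  · exact absurd h (qe_four_zpow_odd_sq_ne d)
  · rcases conjIn_left_normalize (p := 0) (q := 1) hodd (0 : ℕ) c 0
      (qe 4 ^ (2 * d + (1 : ℕ)) * qj) with h | h
    · refine h.trans ?_
      simpa using hstep d
    · refine h.trans ?_
      rw [neg_qe_four_zpow_mul_qj,
        show 2 * d + ((1 : ℕ) : ℤ) + 4 = 2 * (d + 2) + 1 by push_cast; ring]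
      simpa using hstep (d + 2)

theorem conjIn_G₂_dihedral (hodd : Odd m) (c d : ℤ) :
    ConjIn (genGroup m 1 1) (twist (qe (2 * m) ^ (2 * c + 1) * qj) (qe 4 ^ (2 * d + 1) * qj))
      (twist (qi * qj) (qe 4 ^ (1 : ℤ) * qj)) := by
  have hm := hodd.pos.ne'
  have hstep : ∀ d : ℤ, ConjIn (genGroup m 1 1) (twist (qi * qj) (qe 4 ^ (2 * d + 1) * qj))
      (twist (qi * qj) (qe 4 ^ (1 : ℤ) * qj)) := by
    intro d
    have h := ConjIn.of_step (f := fun d : ℤ => twist (qi * qj) (qe 4 ^ (2 * d + 1) * qj))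
      (twist_qj_qi_mem m 1) (fun d => ?_) d 0
    · simpa using h
    · have hL : qj * (qi * qj) * qj⁻¹ = -(qi * qj) := by
        rw [mul_assoc, mul_assoc, mul_inv_cancel, mul_one, ← qe_two]
        have h2 := qj_mul_qe_zpow 2 1
        rw [zpow_one, zpow_neg_one] at h2
        rw [h2, qe_two, qi_inv, neg_mul]
      rw [twist_conj, hL, qe_zpow_conj, ← mul_assoc, ← zpow_natCast, ← zpow_mul, ← zpow_add,
        show (3 : ℤ) * ((2 : ℕ) : ℤ) + (2 * d + 1) = 2 * (d + 1) + 1 + 4 by push_cast; ring,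
        ← neg_qe_four_zpow_mul_qj, twist_neg_neg]
  obtain ⟨n, hn⟩ := hodd
  -- With m = 2n + 1, i = e_{2m}^m is an odd power, so ij is an admissible normal form of the left
  -- factor.
  have hE : qe (2 * m) ^ (2 * (n : ℤ) + 1) = qi := by
    rw [← qe_two_mul_pow hm, ← zpow_natCast]
    congr 1
    rw [hn]
    push_cast
    ring
  rcases conjIn_left_normalize (p := 1) (q := 1) ⟨n, hn⟩ 1 c n
    (qe 4 ^ (2 * d + 1) * qj) with h | h <;> rw [hE] at h
  · exact h.trans (hstep d)
  · refine h.trans ?_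
    rw [neg_qe_four_zpow_mul_qj, show 2 * d + 1 + 4 = 2 * (d + 2) + 1 by ring]
    exact hstep (d + 2)

theorem conjIn_G₂_cyclic (d : ℤ) :
    ConjIn (genGroup m 1 1) (twist qi (qe 4 ^ (2 * d) * qj)) (twist qi (qe 4 ^ (0 : ℤ) * qj)) := by
  have h := ConjIn.of_step (f := fun d : ℤ => twist qi (qe 4 ^ (2 * d) * qj))
    (twist_qj_qi_mem m 1) (fun d => ?_) d 0
  · simpa using h
  · have hL : qj * qi * qj⁻¹ = -qi := by
      have h2 := qj_conj 2 1
      rwa [zpow_one, zpow_neg_one, qe_two, qi_inv] at h2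
    rw [twist_conj, hL, qe_zpow_conj, ← mul_assoc, ← zpow_natCast, ← zpow_mul, ← zpow_add,
      show (3 : ℤ) * ((2 : ℕ) : ℤ) + 2 * d = 2 * (d + 1) + 4 by push_cast; ring,
      ← neg_qe_four_zpow_mul_qj, twist_neg_neg]

/-- The two forms of the elements of `G₂` with a fixed plane. -/
theorem exists_form_G₂ (hodd : Odd m) {g : O4} (hg : g ∈ genGroup m 1 1) {l r : UnitQuat}
    (hl : l ^ 2 = -1) (hr : r ^ 2 = -1) (h : g = twist l r) :
    ∃ c d : ℤ, g = twist qi (qe 4 ^ (2 * d) * qj) ∨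
      g = twist (qe (2 * m) ^ (2 * c + 1) * qj) (qe 4 ^ (2 * d + 1) * qj) := by
  obtain ⟨c, d, ⟨h, h'⟩ | ⟨h, -⟩ | h'⟩ := exists_of_sq_eq_neg_one hodd hg hl hr h
  · rcases zpow_eq_qi_or_neg (qe_two_mul_pow hodd.pos.ne') h with hq | hq <;> rw [hq] at h'
    · exact ⟨c, d, Or.inl h'⟩
    -- The sign of -i moves to the right factor, where -1 = e_4^4 raises d by 2.
    · refine ⟨c, d + 2, Or.inl ?_⟩
      rw [h', twist_neg_left, neg_qe_four_zpow_mul_qj]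
      congr 3
      ring
  · exact absurd h (qe_four_zpow_odd_sq_ne d)
  · exact ⟨c, d, Or.inr (by simpa using h')⟩

/-- Every left factor occurring in the group conjugates i to ±i, never to ±ij. -/
theorem not_conjIn_G₂ (hm : m ≠ 0) (r r' : UnitQuat) :
    ¬ ConjIn (genGroup m 1 1) (twist qi r) (twist (qi * qj) r') := by
  rintro ⟨w, hw, h⟩
  have key : ∀ (l₁ r₁ : UnitQuat) (a : ℤ), (l₁ = qe (2 * m) ^ a ∨ l₁ = qe (2 * m) ^ a * qj) →
      w ≠ twist l₁ r₁ := by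
    rintro l₁ r₁ a hl rfl
    have hE := qe_two_mul_pow hm
    have hij : ∀ a : ℤ, qe (2 * m) ^ a ≠ qi * qj := by
      intro a
      rw [← hE, ← zpow_natCast]
      exact qe_zpow_ne_mul_qj (by omega) _ _
    have h1 : qi ≠ qi * qj := by
      have := hij m
      rwa [zpow_natCast, hE] at this
    have h2 : -qi ≠ qi * qj := by
      have := hij ((2 * m : ℕ) + m)
      rwa [← neg_qe_zpow (by omega), zpow_natCast, hE] at this
    rw [twist_conj] at h
    rcases twist_eq_twist_iff.1 h with ⟨h, -⟩ | ⟨h, -⟩ <;>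
      rcases qi_conj hE hl with h' | h' <;> rw [h'] at h
    · exact h1 h
    · exact h2 h
    · exact h2 (neg_eq_iff_eq_neg.2 h)
    · exact h1 (neg_injective h)
  obtain ⟨c, d, h | h | h | h⟩ := exists_of_mem_genGroup hm hw
  · exact key _ _ _ (Or.inl rfl) h
  · exact key _ _ _ (Or.inl rfl) h
  · exact key _ _ _ (Or.inr rfl) h
  · exact key _ _ _ (Or.inr rfl) h

theorem conjIn_G₃_qi (hodd : Odd m) (c : ℤ) {r : UnitQuat} (hr : r = qi ∨ r = -qi) :
    ConjIn (genGroup m 0 0) (twist (qe (2 * m) ^ (2 * c) * qj) r) (twist qj qi) := by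
  -- Conjugating the right factor by j removes the sign that normalizing the left factor may leave.
  have hneg : ConjIn (genGroup m 0 0) (twist qj (-qi)) (twist qj qi) := by
    refine ⟨_, twist_one_qj_mem m 0 0, ?_⟩
    have h2 := qj_conj 2 1
    rw [zpow_one, zpow_neg_one, qe_two, qi_inv] at h2
    rw [twist_conj, pow_zero, one_mul, inv_one, mul_one, mul_neg, neg_mul, h2, neg_neg]
  have hpm : ∀ r : UnitQuat, (r = qi ∨ r = -qi) →
      ConjIn (genGroup m 0 0) (twist qj r) (twist qj qi) := by
    rintro r (rfl | rfl)
    · exact ConjIn.refl _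
    · exact hneg
  rcases conjIn_left_normalize (p := 0) (q := 0) hodd 0 c 0 r with h | h <;>
    simp only [add_zero, mul_zero, zpow_zero, one_mul] at h
  · exact h.trans (hpm r hr)
  · refine h.trans (hpm (-r) ?_)
    rcases hr with rfl | rfl
    · exact Or.inr rfl
    · exact Or.inl (neg_neg qi)

theorem conjIn_G₃_qj (hodd : Odd m) (c d : ℤ) :
    ConjIn (genGroup m 0 0) (twist (qe (2 * m) ^ (2 * c) * qj) (qe 4 ^ (2 * d) * qj))
        (twist qj (qe 4 ^ (0 : ℤ) * qj)) ∨
      ConjIn (genGroup m 0 0) (twist (qe (2 * m) ^ (2 * c) * qj) (qe 4 ^ (2 * d) * qj))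
        (twist qj (qe 4 ^ (2 : ℤ) * qj)) := by
  have hstep : ∀ e n : ℤ, ConjIn (genGroup m 0 0) (twist qj (qe 4 ^ (4 * n + e) * qj))
      (twist qj (qe 4 ^ e * qj)) := by
    intro e n
    have h := ConjIn.of_step (f := fun n : ℤ => twist qj (qe 4 ^ (4 * n + e) * qj))
      (twist_qi_mem m 0 0 1) (fun n => ?_) n 0
    · simpa using h
    · rw [twist_conj, ← qe_four_zpow, qe_zpow_conj, ← mul_assoc, ← zpow_natCast, ← zpow_mul,
        ← zpow_add, one_mul, inv_one, mul_one]
      congr 3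
      push_cast
      ring
  have hall : ∀ d : ℤ, ConjIn (genGroup m 0 0) (twist qj (qe 4 ^ (2 * d) * qj))
        (twist qj (qe 4 ^ (0 : ℤ) * qj)) ∨
      ConjIn (genGroup m 0 0) (twist qj (qe 4 ^ (2 * d) * qj))
        (twist qj (qe 4 ^ (2 : ℤ) * qj)) := by
    intro d
    obtain ⟨n, rfl | rfl⟩ := Int.even_or_odd' d
    · left
      convert hstep 0 n using 5
      ring
    · right
      convert hstep 2 n using 5
      ring
  rcases conjIn_left_normalize (p := 0) (q := 0) hodd 0 c 0 (qe 4 ^ (2 * d) * qj) with h | h <;>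
    simp only [add_zero, mul_zero, zpow_zero, one_mul] at h
  · exact (hall d).imp h.trans h.trans
  · rw [neg_qe_four_zpow_mul_qj, show 2 * d + 4 = 2 * (d + 2) by ring] at h
    exact (hall (d + 2)).imp h.trans h.trans

theorem conjIn_G₃ (hodd : Odd m) {g : O4} (hg : g ∈ genGroup m 0 0) {l r : UnitQuat}
    (hl : l ^ 2 = -1) (hr : r ^ 2 = -1) (h : g = twist l r) :
    ConjIn (genGroup m 0 0) g (twist qj qi) ∨
      ConjIn (genGroup m 0 0) g (twist qj (qe 4 ^ (0 : ℤ) * qj)) ∨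
      ConjIn (genGroup m 0 0) g (twist qj (qe 4 ^ (2 : ℤ) * qj)) := by
  obtain ⟨c, d, ⟨h', -⟩ | ⟨h', rfl⟩ | rfl⟩ := exists_of_sq_eq_neg_one hodd hg hl hr h
  · exact absurd (by simpa using h') (qe_zpow_sq_ne_neg_one hodd c)
  · left
    simpa using conjIn_G₃_qi hodd c (zpow_eq_qi_or_neg qe_four_sq h')
  · right
    simpa using conjIn_G₃_qj hodd c d

/-- The right factors of the elements of `G₃`. -/
theorem exists_right_G₃ (hm : m ≠ 0) {w : O4} (hw : w ∈ genGroup m 0 0) :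
    ∃ (l r : UnitQuat) (d : ℤ), w = twist l r ∧ (r = qe 4 ^ (2 * d) ∨ r = qe 4 ^ (2 * d) * qj) := by
  obtain ⟨c, d, h | h | h | h⟩ := exists_of_mem_genGroup hm hw
  · exact ⟨_, _, d, h, Or.inl rfl⟩
  · exact ⟨_, _, d, h, Or.inr rfl⟩
  · exact ⟨_, _, d, h, Or.inl (by simp)⟩
  · exact ⟨_, _, d, h, Or.inr (by simp)⟩

theorem not_conjIn_G₃_qi (hm : m ≠ 0) (l l' : UnitQuat) (e : ℤ) :
    ¬ ConjIn (genGroup m 0 0) (twist l qi) (twist l' (qe 4 ^ e * qj)) := by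
  rintro ⟨w, hw, h⟩
  obtain ⟨l₁, r₁, d, rfl, hr⟩ := exists_right_G₃ hm hw
  have h1 : ∀ e : ℤ, qi ≠ qe 4 ^ e * qj := by
    intro e
    rw [← qe_four_sq, ← zpow_natCast]
    exact qe_zpow_ne_mul_qj (by norm_num) _ _
  have h2 : -qi ≠ qe 4 ^ e * qj := by
    intro h
    refine h1 (e + 4) ?_
    rw [← neg_qe_four_zpow_mul_qj, ← h, neg_neg]
  rw [twist_conj] at h
  rcases twist_eq_twist_iff.1 h with ⟨-, h⟩ | ⟨-, h⟩ <;>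
    rcases qi_conj qe_four_sq hr with h' | h' <;> rw [h'] at h
  · exact h1 e h
  · exact h2 h
  · exact h2 (by rw [h, neg_neg])
  · exact h1 e (neg_injective h)

/-- The right factors are e_4^{2d} and e_4^{2d} j, which conjugate j to e_4^{4d} j. The target
exponent is 2, or 6 after a change of sign, modulo the order 8; neither is divisible by 4. -/
theorem not_conjIn_G₃_qj (hm : m ≠ 0) (l l' : UnitQuat) :
    ¬ ConjIn (genGroup m 0 0) (twist l (qe 4 ^ (0 : ℤ) * qj)) (twist l' (qe 4 ^ (2 : ℤ) * qj)) := by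
  rintro ⟨w, hw, h⟩
  obtain ⟨l₁, r₁, d, rfl, hr⟩ := exists_right_G₃ hm hw
  have hconj : r₁ * (qe 4 ^ (0 : ℤ) * qj) * r₁⁻¹ = qe 4 ^ (4 * d) * qj := by
    have h1 : qe 4 ^ (2 * d) * (qe 4 ^ (0 : ℤ) * qj) * (qe 4 ^ (2 * d))⁻¹ = qe 4 ^ (4 * d) * qj := by
      rw [qe_zpow_conj, zpow_zero, one_mul, ← zpow_natCast, ← zpow_mul]
      congr 2
      push_cast
      ring
    rcases hr with rfl | rfl
    · exact h1
    · rw [← h1]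
      group
  have h8 : ∀ e : ℤ, ¬ (8 : ℤ) ∣ 4 * d - e → qe 4 ^ (4 * d) * qj ≠ qe 4 ^ e * qj := by
    intro e he h
    have h1 : qe 4 ^ (4 * d - e) = 1 := by
      rw [zpow_sub, mul_right_cancel h, mul_inv_cancel]
    rw [← orderOf_dvd_iff_zpow_eq_one, orderOf_qe four_ne_zero] at h1
    exact he h1
  rw [twist_conj, hconj] at h
  rcases twist_eq_twist_iff.1 h with ⟨-, h⟩ | ⟨-, h⟩
  · exact h8 2 (by omega) h
  · rw [neg_qe_four_zpow_mul_qj] at h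
    exact h8 _ (by omega) h

end Classes

/-! ### Isotropy types -/

section Main

variable {m : ℕ}

theorem ncard_isotropyTypes_G₁ (hodd : Odd m) : (isotropyTypes (genGroup m 0 1)).ncard = 1 := by
  have hG := isSimplyReflected_genGroup (m := m) (p := 0) (q := 1) hodd (Or.inl rfl)
  obtain ⟨H₀, hH₀⟩ := hG.isotropy_properties.1
  refine Set.ncard_eq_one.2 ⟨conjClass H₀, Set.eq_singleton_iff_unique_mem.2
    ⟨⟨H₀, hH₀, rfl⟩, ?_⟩⟩
  rintro _ ⟨H, hH, rfl⟩
  obtain ⟨h₀, l₀, r₀, hl₀, hr₀, hh₀, rfl⟩ := hG.mem_nontrivialIsotropy_iff.1 hH₀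
  obtain ⟨h, l, r, hl, hr, hh, rfl⟩ := hG.mem_nontrivialIsotropy_iff.1 hH
  exact ((conjIn_G₁ hodd h.2 hl hr hh).trans
    (conjIn_G₁ hodd h₀.2 hl₀ hr₀ hh₀).symm).conjClass_eq

theorem normalizerActsAs_G₁ (hodd : Odd m) {H : Subgroup (genGroup m 0 1)}
    (hH : H ∈ nontrivialIsotropy (genGroup m 0 1)) :
    NormalizerActsAs (genGroup m 0 1) H (DihedralGroup 2) 2 Real.pi := by
  have hG := isSimplyReflected_genGroup (m := m) (p := 0) (q := 1) hodd (Or.inl rfl)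
  obtain ⟨h, l, r, hl, hr, hh, rfl⟩ := hG.mem_nontrivialIsotropy_iff.1 hH
  obtain ⟨c, d, ⟨h', -⟩ | ⟨h', -⟩ | h'⟩ := exists_of_sq_eq_neg_one hodd h.2 hl hr hh
  · exact absurd (by simpa using h') (qe_zpow_sq_ne_neg_one hodd c)
  · exact absurd h' (qe_four_zpow_odd_sq_ne d)
  · exact normalizerActsAs_dihedral hodd h'

theorem isotropyTypes_G₂ (hodd : Odd m) : ∃ T₁ T₂ : Set (Subgroup (genGroup m 1 1)), T₁ ≠ T₂ ∧
    isotropyTypes (genGroup m 1 1) = {T₁, T₂} ∧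
    (∀ H ∈ T₁, NormalizerActsAs (genGroup m 1 1) H (DihedralGroup 2) 2 Real.pi) ∧
    (∀ H ∈ T₂, NormalizerActsAs (genGroup m 1 1) H
      (Multiplicative (ZMod (2 * m) × ZMod 2)) (2 * m) (Real.pi / m)) := by
  have hm := hodd.pos.ne'
  have hG := isSimplyReflected_genGroup (m := m) (p := 1) (q := 1) hodd (Or.inr rfl)
  -- With m = 2n + 1, the product of (e_m^n, 1) and (e_{2m}, j) is (e_{2m}^m, j) = (i, j).
  have hB : twist qi (qe 4 ^ (0 : ℤ) * qj) ∈ genGroup m 1 1 := by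
    obtain ⟨n, hn⟩ := hodd
    refine twist_mem_of_eq_mul (twist_qe_mem m 1 1 n) (twist_one_qj_mem m 1 1) ?_ (by simp)
    rw [zpow_natCast, ← qe_two_mul_sq hm, ← pow_mul, ← pow_add, ← hn, qe_two_mul_pow hm]
  -- The product (1, i)(i, j)(j, e_4) has right factor i j e_4 = e_4² e_4⁻¹ j = e_4 j.
  have hD : twist (qi * qj) (qe 4 ^ (1 : ℤ) * qj) ∈ genGroup m 1 1 := by
    have h := (genGroup m 1 1).mul_mem hB (twist_qj_one_mem m 1 1)
    have h' := (genGroup m 1 1).mul_mem (twist_qi_mem m 1 1 1) h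
    rw [twist_mul, twist_mul] at h'
    convert h' using 2
    · rw [one_mul]
    · rw [zpow_zero, one_mul, ← zpow_natCast, qj_mul_qe_zpow, ← mul_assoc, ← qe_four_zpow,
        ← zpow_add]
      rfl
  have hij : (qi * qj) ^ 2 = -1 := by
    rw [← qe_two_mul_pow hm, ← zpow_natCast (qe (2 * m)) m, qe_zpow_mul_qj_sq]
  let hb : genGroup m 1 1 := ⟨_, hB⟩
  let hd : genGroup m 1 1 := ⟨_, hD⟩
  have hne : conjClass (Subgroup.zpowers hb) ≠ conjClass (Subgroup.zpowers hd) := fun hc =>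
    not_conjIn_G₂ hm _ _ (ConjIn.of_conjClass_eq qi_sq (qe_zpow_mul_qj_sq _ _) hij rfl rfl hc)
  have hform : ∀ (h : genGroup m 1 1) (l r : UnitQuat), l ^ 2 = -1 → r ^ 2 = -1 →
      (h : O4) = twist l r →
      (conjClass (Subgroup.zpowers h) = conjClass (Subgroup.zpowers hd) ∧
        NormalizerActsAs (genGroup m 1 1) (Subgroup.zpowers h) (DihedralGroup 2) 2 Real.pi) ∨
      (conjClass (Subgroup.zpowers h) = conjClass (Subgroup.zpowers hb) ∧
        NormalizerActsAs (genGroup m 1 1) (Subgroup.zpowers h)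
          (Multiplicative (ZMod (2 * m) × ZMod 2)) (2 * m) (Real.pi / m)) := by
    intro h l r hl hr hh
    obtain ⟨c, d, h' | h'⟩ := exists_form_G₂ hodd h.2 hl hr hh
    · refine Or.inr ⟨ConjIn.conjClass_eq ?_, normalizerActsAs_cyclic hodd h'⟩
      rw [h']
      exact conjIn_G₂_cyclic d
    · refine Or.inl ⟨ConjIn.conjClass_eq ?_, normalizerActsAs_dihedral hodd h'⟩
      rw [h']
      exact conjIn_G₂_dihedral hodd c d
  -- Each member of a class is again generated by an involution with l² = r² = -1, so `hform`
  -- applies to it directly; the distinctness of the two classes then selects the right alternative.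
  have hmem : ∀ (h : genGroup m 1 1) (l r : UnitQuat), l ^ 2 = -1 → r ^ 2 = -1 →
      (h : O4) = twist l r → ∀ H ∈ conjClass (Subgroup.zpowers h),
      ∃ (h' : genGroup m 1 1) (l' r' : UnitQuat), l' ^ 2 = -1 ∧ r' ^ 2 = -1 ∧
        (h' : O4) = twist l' r' ∧ H = Subgroup.zpowers h' ∧
        conjClass (Subgroup.zpowers h') = conjClass (Subgroup.zpowers h) := by
    rintro h l r hl hr hh _ ⟨g, rfl⟩
    obtain ⟨c, d, hg⟩ := exists_of_mem_genGroup hm g.2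
    obtain ⟨l₁, r₁, hg⟩ : ∃ l₁ r₁ : UnitQuat, (g : O4) = twist l₁ r₁ := by
      rcases hg with hg | hg | hg | hg <;> exact ⟨_, _, hg⟩
    refine ⟨g * h * g⁻¹, l₁ * l * l₁⁻¹, r₁ * r * r₁⁻¹, (UnitQuat.sq_neg_of_conj rfl).2 hl,
      (UnitQuat.sq_neg_of_conj rfl).2 hr, ?_, map_conj_zpowers g h, ?_⟩
    · rw [← twist_conj, ← hg, ← hh]
      rfl
    · rw [← map_conj_zpowers, conjClass_map]
  have hrD := qe_zpow_mul_qj_sq 4 1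
  have hrB := qe_zpow_mul_qj_sq 4 0
  refine ⟨conjClass (Subgroup.zpowers hd), conjClass (Subgroup.zpowers hb), hne.symm, ?_, ?_, ?_⟩
  · ext T
    constructor
    · rintro ⟨H, hH, rfl⟩
      obtain ⟨h, l, r, hl, hr, hh, rfl⟩ := hG.mem_nontrivialIsotropy_iff.1 hH
      exact (hform h l r hl hr hh).imp And.left And.left
    · rintro (rfl | rfl)
      · exact ⟨_, hG.mem_nontrivialIsotropy_iff.2 ⟨hd, _, _, hij, hrD, rfl, rfl⟩, rfl⟩
      · exact ⟨_, hG.mem_nontrivialIsotropy_iff.2 ⟨hb, _, _, qi_sq, hrB, rfl, rfl⟩, rfl⟩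
  · intro H hH
    obtain ⟨h, l, r, hl, hr, hh, rfl, hc⟩ := hmem hd _ _ hij hrD rfl H hH
    rcases hform h l r hl hr hh with ⟨-, h'⟩ | ⟨h', -⟩
    · exact h'
    · exact absurd (h'.symm.trans hc) hne
  · intro H hH
    obtain ⟨h, l, r, hl, hr, hh, rfl, hc⟩ := hmem hb _ _ qi_sq hrB rfl H hH
    rcases hform h l r hl hr hh with ⟨h', -⟩ | ⟨-, h'⟩
    · exact absurd (hc.symm.trans h') hne
    · exact h'

theorem ncard_isotropyTypes_G₃ (hodd : Odd m) : (isotropyTypes (genGroup m 0 0)).ncard = 3 := by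
  have hm := hodd.pos.ne'
  have hG := isSimplyReflected_genGroup (m := m) (p := 0) (q := 0) hodd (Or.inl rfl)
  have hj : twist qj 1 ∈ genGroup m 0 0 := by
    simpa using twist_qj_one_mem m 0 0
  have hi : twist 1 qi ∈ genGroup m 0 0 := by
    simpa using twist_qi_mem m 0 0 1
  have hj' : twist 1 qj ∈ genGroup m 0 0 := by
    simpa using twist_one_qj_mem m 0 0
  have h1 : twist qj qi ∈ genGroup m 0 0 :=
    twist_mem_of_eq_mul hj hi (mul_one _).symm (one_mul _).symm
  have h2 : twist qj (qe 4 ^ (0 : ℤ) * qj) ∈ genGroup m 0 0 :=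
    twist_mem_of_eq_mul hj hj' (mul_one _).symm (by simp)
  have h3 : twist qj (qe 4 ^ (2 : ℤ) * qj) ∈ genGroup m 0 0 := by
    refine twist_mem_of_eq_mul h1 hj' (mul_one _).symm ?_
    rw [zpow_ofNat, qe_four_sq]
  have hr2 := qe_zpow_mul_qj_sq 4 0
  have hr3 := qe_zpow_mul_qj_sq 4 2
  refine Set.ncard_eq_three.2 ⟨conjClass (Subgroup.zpowers ⟨_, h1⟩),
    conjClass (Subgroup.zpowers ⟨_, h2⟩), conjClass (Subgroup.zpowers ⟨_, h3⟩), ?_, ?_, ?_, ?_⟩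
  · exact fun hc => not_conjIn_G₃_qi hm _ _ _ (ConjIn.of_conjClass_eq qj_sq qi_sq qj_sq rfl rfl hc)
  · exact fun hc => not_conjIn_G₃_qi hm _ _ _ (ConjIn.of_conjClass_eq qj_sq qi_sq qj_sq rfl rfl hc)
  · exact fun hc => not_conjIn_G₃_qj hm _ _ (ConjIn.of_conjClass_eq qj_sq hr2 qj_sq rfl rfl hc)
  · ext T
    constructor
    · rintro ⟨H, hH, rfl⟩
      obtain ⟨h, l, r, hl, hr, hh, rfl⟩ := hG.mem_nontrivialIsotropy_iff.1 hH
      exact (conjIn_G₃ hodd h.2 hl hr hh).imp (fun hc => ConjIn.conjClass_eq hc)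
        (Or.imp (fun hc => ConjIn.conjClass_eq hc) fun hc => ConjIn.conjClass_eq hc)
    · rintro (rfl | rfl | rfl)
      · exact ⟨_, hG.mem_nontrivialIsotropy_iff.2 ⟨_, _, _, qj_sq, qi_sq, rfl, rfl⟩, rfl⟩
      · exact ⟨_, hG.mem_nontrivialIsotropy_iff.2 ⟨_, _, _, qj_sq, hr2, rfl, rfl⟩, rfl⟩
      · exact ⟨_, hG.mem_nontrivialIsotropy_iff.2 ⟨_, _, _, qj_sq, hr3, rfl, rfl⟩, rfl⟩

theorem normalizerActsAs_G₃ (hodd : Odd m) {H : Subgroup (genGroup m 0 0)}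
    (hH : H ∈ nontrivialIsotropy (genGroup m 0 0)) :
    NormalizerActsAs (genGroup m 0 0) H (Multiplicative (ZMod 4 × ZMod 2)) 4 (Real.pi / 2) := by
  have hG := isSimplyReflected_genGroup (m := m) (p := 0) (q := 0) hodd (Or.inl rfl)
  have hi : ∀ d : ℤ, twist 1 (qe 4 ^ (2 * d)) ∈ genGroup m 0 0 := by
    intro d
    rw [qe_four_zpow]
    exact twist_qi_mem m 0 0 d
  have hj : twist 1 qj ∈ genGroup m 0 0 := by
    simpa using twist_one_qj_mem m 0 0
  obtain ⟨h, l, r, hl, hr, hh, rfl⟩ := hG.mem_nontrivialIsotropy_iff.1 hH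
  obtain ⟨c, d, ⟨h', -⟩ | ⟨hq, h'⟩ | h'⟩ := exists_of_sq_eq_neg_one hodd h.2 hl hr hh
  · exact absurd (by simpa using h') (qe_zpow_sq_ne_neg_one hodd c)
  · exact normalizerActsAs_quarter hodd hq (by simpa using hi d) h'
  · exact normalizerActsAs_quarter hodd (qe_zpow_mul_qj_sq _ _)
      (twist_mem_of_eq_mul (hi d) hj (one_mul 1).symm (by simp)) h'

end Main

end QuatSeries

end

theorem mainTheorem1 (m : ℕ) (hm : 3 ≤ m) :
    -- the groups consist of rotations, and their natural actions are absolutely irreducible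
    (∀ G ∈ ({QuatSeries.G₁ m, QuatSeries.G₂ m, QuatSeries.G₃ m} : Set (Subgroup QuatSeries.O4)),
      G ≤ QuatSeries.SO4 ∧
        QuatSeries.IsAbsolutelyIrreducible (QuatSeries.naturalRep G)) ∧
    (Odd m →
      -- isotropy subgroups and their fixed point spaces
      (∀ G ∈ ({QuatSeries.G₁ m, QuatSeries.G₂ m, QuatSeries.G₃ m} : Set (Subgroup QuatSeries.O4)),
        (QuatSeries.nontrivialIsotropy G).Nonempty ∧
        (∀ H ∈ QuatSeries.nontrivialIsotropy G,
          Nat.card H = 2 ∧ Module.finrank ℝ (QuatSeries.fixSpace G H) = 2) ∧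
        (∀ x : Quaternion ℝ,
          ¬ Odd (Module.finrank ℝ (QuatSeries.fixSpace G (QuatSeries.isotropy G x))))) ∧
      -- the number of isotropy types
      (QuatSeries.isotropyTypes (QuatSeries.G₁ m)).ncard = 1 ∧
      (QuatSeries.isotropyTypes (QuatSeries.G₂ m)).ncard = 2 ∧
      (QuatSeries.isotropyTypes (QuatSeries.G₃ m)).ncard = 3 ∧
      -- the normalizers and their actions on the fixed planes
      (∀ H ∈ QuatSeries.nontrivialIsotropy (QuatSeries.G₁ m),
        QuatSeries.NormalizerActsAs (QuatSeries.G₁ m) H (DihedralGroup 2) 2 Real.pi) ∧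
      (∃ T₁ T₂ : Set (Subgroup (QuatSeries.G₂ m)), T₁ ≠ T₂ ∧
        QuatSeries.isotropyTypes (QuatSeries.G₂ m) = {T₁, T₂} ∧
        (∀ H ∈ T₁,
          QuatSeries.NormalizerActsAs (QuatSeries.G₂ m) H (DihedralGroup 2) 2 Real.pi) ∧
        (∀ H ∈ T₂,
          QuatSeries.NormalizerActsAs (QuatSeries.G₂ m) H
            (Multiplicative (ZMod (2 * m) × ZMod 2)) (2 * m) (Real.pi / m))) ∧
      (∀ H ∈ QuatSeries.nontrivialIsotropy (QuatSeries.G₃ m),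
        QuatSeries.NormalizerActsAs (QuatSeries.G₃ m) H
          (Multiplicative (ZMod 4 × ZMod 2)) 4 (Real.pi / 2))) := by
  rw [QuatSeries.G₁_eq, QuatSeries.G₂_eq, QuatSeries.G₃_eq]
  refine ⟨?_, fun hodd => ⟨?_, QuatSeries.ncard_isotropyTypes_G₁ hodd, ?_,
    QuatSeries.ncard_isotropyTypes_G₃ hodd, fun H hH => QuatSeries.normalizerActsAs_G₁ hodd hH,
    QuatSeries.isotropyTypes_G₂ hodd, fun H hH => QuatSeries.normalizerActsAs_G₃ hodd hH⟩⟩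
  · rintro G (rfl | rfl | rfl) <;>
      exact ⟨QuatSeries.genGroup_le_SO4 _ _ _, QuatSeries.isAbsolutelyIrreducible_genGroup hm _ _⟩
  · rintro G (rfl | rfl | rfl)
    · exact (QuatSeries.isSimplyReflected_genGroup hodd (Or.inl rfl)).isotropy_properties
    · exact (QuatSeries.isSimplyReflected_genGroup hodd (Or.inr rfl)).isotropy_properties
    · exact (QuatSeries.isSimplyReflected_genGroup hodd (Or.inl rfl)).isotropy_properties
  · obtain ⟨T₁, T₂, hne, h, -⟩ := QuatSeries.isotropyTypes_G₂ hodd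
    rw [h, Set.ncard_pair hne]
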